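/- **Games.** A game has a finite set $\Pi$ of players containing a player $\mathbb{L}$ (Leader), a finite directed graph $(V,E)$ in which every vertex has an outgoing edge, a partition $(V_i)_{i\in\Pi}$ of $V$ (vertices controlled by $i$; some $V_i$ may be empty), and payoffs $\mu_i$ on infinite paths (plays). It is a *discounted-sum game* if there are a rational $\lambda\in(0,1)$ and reward mappings $r_i:E\to\mathbb{Q}$ with $\mu_i(\pi)=\sum_{k\ge 0}\lambda^k r_i(\pi_k\pi_{k+1})$ for every play $\pi$ and every $i$. Fix an initial vertex $v_0$. A strategy $\sigma_i$ of player $i$ maps every history (nonempty finite path) from $v_0$ ending in a vertex $v\in V_i$ to a successor of $v$; a history $h$ is compatible with $\sigma_i$ if $h_{k+1}=\sigma_i(h_0\dots h_k)$ whenever $h_k\in V_i$. The outcome $\langle\bar\sigma\rangle$ of a complete strategy profile is the unique play from $v_0$ compatible with all its strategies. **Rationality.** A profile $\bar\sigma$ is an *$\mathbb{L}$-fixed Nash equilibrium* if $\mu_i(\langle\sigma_i',\bar\sigma_{-i}\rangle)\le\mu_i(\langle\bar\sigma\rangle)$ for every player $i\ne\mathbb{L}$ and every strategy $\sigma_i'$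 of $i$. It is an *$\mathbb{L}$-fixed subgame-perfect equilibrium* if for every history $hv$ from $v_0$ compatible with $\sigma_{\mathbb{L}}$, the profile of substrategies $h'\mapsto\sigma_i(hh')$ is an $\mathbb{L}$-fixed Nash equilibrium in the game starting from $v$ with payoffs $\pi\mapsto\mu(h\pi)$. **Mealy machines.** A Mealy machine for Leader is a tuple $\mathcal{M}=(Q,q_0,\Delta)$ with $Q$ finite, $q_0\in Q$ and $\Delta\subseteq (Q\times (V\setminus V_{\mathbb{L}})\times Q)\cup(Q\times V_{\mathbb{L}}\times Q\times V)$, such that $uv\in E$ for all $(p,u,q,v)\in\Delta$, and such that for all $p\in Q$, $u\in V$ there is a transition $(p,u,q)$ or $(p,u,q,v)$ in $\Delta$; it is *deterministic* if there is exactly one for all $p,u$. A strategy $\sigma_{\mathbb{L}}$ is compatible with $\mathcal{M}$ if there is a map $h\mapsto q_h\in Q$ on the (possibly empty) histories from $v_0$, with $q_h=q_0$ for the empty history $h$, such that for every history $hv$ from $v_0$: $(q_h,v,q_{hv})\in\Delta$ if $v\notin V_{\mathbb{L}}$, and $(q_h,v,q_{hv},\sigma_{\mathbb{L}}(hv))\in\Delta$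 if $v\in V_{\mathbb{L}}$. **Problems.** For $\rho\in\{\text{Nash},\text{subgame-perfect}\}$, the *(deterministic) $\rho$-rational verification problem* in discounted-sum games is: given a discounted-sum game with an initial vertex $v_0$, a threshold $t\in\mathbb{Q}$ and a (deterministic) Mealy machine $\mathcal{M}$ for Leader, does every $\mathbb{L}$-fixed $\rho$-equilibrium $\bar\sigma$ such that $\sigma_{\mathbb{L}}$ is compatible with $\mathcal{M}$ satisfy $\mu_{\mathbb{L}}(\langle\bar\sigma\rangle)>t$? Instances are encoded by their finite data (tables of owners, edges, rewards and transitions, with rationals as reduced fractions). **Theorem.** In discounted-sum games, the Nash rational verification problem, the subgame-perfect rational verification problem, the deterministic Nash rational verification problem and the deterministic subgame-perfect rational verification problem are recursively enumerable: in each case, the set of encodings of positive instances is recursively enumerable. -/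

import Mathlib

namespace RationalVerification

/-! ### Games, histories, strategies

A nonempty history `h₀ … hₙ` is written as a pair: the list `[h₀, …, hₙ₋₁]` of its past vertices and
its last vertex `hₙ`. -/

/-- Non-initialized games with set of players `P` and set of vertices `V`: every vertex `v` is
controlled by exactly one player `owner v` and has an outgoing edge.  The payoff is a total function
on infinite sequences of vertices, only its values on plays matter. -/
structure Game (P V : Type*) where
  owner : V → P
  Edge : V → V → Prop
  exists_edge : ∀ u, ∃ v, Edge u v
  payoff : (ℕ → V) → P → ℝ

/-- The infinite sequence `h π`. -/
def prepend {V : Type*} (h : List V) (π : ℕ → V) : ℕ → V :=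
  fun n => (h[n]?).getD (π (n - h.length))

namespace Game

variable {P V : Type*}

/-- `hv` is a history of the game initialized in `v₀`. -/
def IsHist (G : Game P V) (v₀ : V) (h : List V) (v : V) : Prop :=
  (h ++ [v]).IsChain G.Edge ∧ (h ++ [v]).head? = some v₀

/-- `s` is a strategy for player `i` in the game initialized in `v₀`: it maps every history `hv`
with `v` controlled by `i` to a successor of `v` (other values of `s` are irrelevant). -/
def IsStrategy (G : Game P V) (v₀ : V) (i : P) (s : List V → V → V) : Prop :=
  ∀ h v, G.IsHist v₀ h v → G.owner v = i → G.Edge v (s h v)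

/-- `σ` is a complete strategy profile in the game initialized in `v₀`. -/
def IsProfile (G : Game P V) (v₀ : V) (σ : P → List V → V → V) : Prop :=
  ∀ i, G.IsStrategy v₀ i (σ i)

/-- The history `hv` is compatible with the strategy `s` of player `i`. -/
def HistCompatible (G : Game P V) (i : P) (s : List V → V → V) (h : List V) (v : V) : Prop :=
  ∀ (a : List V) (u w : V) (b : List V),
    h ++ [v] = a ++ u :: w :: b → G.owner u = i → w = s a u

/-- The history of length `n + 1` that is generated from `v₀` by the profile `σ`. -/
def run (G : Game P V) (v₀ : V) (σ : P → List V → V → V) : ℕ → List V × V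
  | 0 => ([], v₀)
  | n + 1 =>
    let hv := run G v₀ σ n
    (hv.1 ++ [hv.2], σ (G.owner hv.2) hv.1 hv.2)

/-- The outcome of the complete strategy profile `σ` from `v₀`. -/
def outcome (G : Game P V) (v₀ : V) (σ : P → List V → V → V) : ℕ → V :=
  fun n => (G.run v₀ σ n).2

/-- The subgame after a history `hv`, to be initialized in `v`: its payoff is `π ↦ μ (h π)`. -/
def subgame (G : Game P V) (h : List V) : Game P V where
  owner := G.owner
  Edge := G.Edge
  exists_edge := G.exists_edge
  payoff := fun π => G.payoff (prepend h π)

/-- The profile of substrategies `h' ↦ σ (h h')` after a history `hv`. -/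
def subprofile (σ : P → List V → V → V) (h : List V) : P → List V → V → V :=
  fun i h' v' => σ i (h ++ h') v'

/-- `σ` is an `L`-fixed Nash equilibrium in the game initialized in `v₀`: no player other than `L`
has a profitable deviation. -/
def IsFixedNE [DecidableEq P] (G : Game P V) (v₀ : V) (L : P) (σ : P → List V → V → V) : Prop :=
  ∀ i, i ≠ L → ∀ s, G.IsStrategy v₀ i s →
    G.payoff (G.outcome v₀ (Function.update σ i s)) i ≤ G.payoff (G.outcome v₀ σ) i

/-- `σ` is an `L`-fixed subgame-perfect equilibrium in the game initialized in `v₀`: in the subgame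
after every history compatible with the strategy of `L`, it induces an `L`-fixed Nash equilibrium. -/
def IsFixedSPE [DecidableEq P] (G : Game P V) (v₀ : V) (L : P) (σ : P → List V → V → V) : Prop :=
  ∀ h v, G.IsHist v₀ h v → G.HistCompatible L (σ L) h v →
    (G.subgame h).IsFixedNE v L (subprofile σ h)

end Game

/-- The two notions of rationality. -/
inductive Rationality
  | nash
  | subgamePerfect

/-- `L`-fixed `ρ`-equilibria. -/
def Game.IsFixedEquilibrium {P V : Type*} [DecidableEq P] (G : Game P V) (ρ : Rationality)
    (v₀ : V) (L : P) (σ : P → List V → V → V) : Prop :=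
  match ρ with
  | .nash => G.IsFixedNE v₀ L σ
  | .subgamePerfect => G.IsFixedSPE v₀ L σ

/-! ### Mealy machines -/

/-- (Non-deterministic) Mealy machines for player `i` on `G`, with set of states `Q`.  The
transitions `(p, u, q)` (with `u` not controlled by `i`) are given by `silent`, the transitions
`(p, u, q, v)` (with `u` controlled by `i`) by `output`. -/
structure Mealy {P V : Type*} (G : Game P V) (i : P) (Q : Type*) where
  init : Q
  silent : Q → V → Q → Prop
  output : Q → V → Q → V → Prop
  silent_owner : ∀ p u q, silent p u q → G.owner u ≠ i
  output_owner : ∀ p u q v, output p u q v → G.owner u = i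
  output_edge : ∀ p u q v, output p u q v → G.Edge u v
  exists_transition : ∀ p u, (∃ q, silent p u q) ∨ ∃ q v, output p u q v

namespace Mealy

variable {P V Q : Type*} {G : Game P V} {i : P}

/-- For every state `p` and vertex `u` there is exactly one transition `(p, u, q)` or
`(p, u, q, v)`. -/
def Deterministic (M : Mealy G i Q) : Prop :=
  ∀ p u, (G.owner u ≠ i → ∃! q, M.silent p u q) ∧
    (G.owner u = i → ∃! qv : Q × V, M.output p u qv.1 qv.2)

/-- The strategy `s` of player `i` in the game initialized in `v₀` is compatible with `M`:
histories can be labelled by states, from the initial state for the empty one, in such a way that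
all transitions taken are transitions of `M`. -/
def Compatible (M : Mealy G i Q) (v₀ : V) (s : List V → V → V) : Prop :=
  ∃ q : List V → Q, q [] = M.init ∧ ∀ h v, G.IsHist v₀ h v →
    (G.owner v ≠ i → M.silent (q h) v (q (h ++ [v]))) ∧
    (G.owner v = i → M.output (q h) v (q (h ++ [v])) (s h v))

end Mealy

/-! ### Discounted-sum games -/

/-- Discounted-sum games, given by their finite data.  Rewards of pairs that are not edges are
irrelevant. -/
structure DSGame (P V : Type*) where
  owner : V → P
  Edge : V → V → Prop
  exists_edge : ∀ u, ∃ v, Edge u v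
  reward : P → V → V → ℚ
  discount : ℚ
  discount_pos : 0 < discount
  discount_lt_one : discount < 1

/-- The game with payoffs `μ_i(π) = ∑ₖ λᵏ r_i(πₖ πₖ₊₁)`. -/
noncomputable def DSGame.toGame {P V : Type*} (D : DSGame P V) : Game P V where
  owner := D.owner
  Edge := D.Edge
  exists_edge := D.exists_edge
  payoff := fun π i => ∑' k : ℕ, (D.discount : ℝ) ^ k * (D.reward i (π k) (π (k + 1)) : ℝ)

/-! ### The decision problems -/

/-- Instances of the rational verification problem in discounted-sum games, with `n` players, `m`
vertices and a machine with `k` states. -/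
structure Instance (n m k : ℕ) where
  game : DSGame (Fin n) (Fin m)
  start : Fin m
  leader : Fin n
  threshold : ℚ
  machine : Mealy game.toGame leader (Fin k)

/-- Positive instances: every `L`-fixed `ρ`-equilibrium in which the strategy of Leader is
compatible with the machine gives Leader a payoff greater than the threshold. -/
def Instance.Positive {n m k : ℕ} (I : Instance n m k) (ρ : Rationality) : Prop :=
  ∀ σ : Fin n → List (Fin m) → Fin m → Fin m,
    I.game.toGame.IsProfile I.start σ →
    I.game.toGame.IsFixedEquilibrium ρ I.start I.leader σ →
    I.machine.Compatible I.start (σ I.leader) →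
    (I.threshold : ℝ) < I.game.toGame.payoff (I.game.toGame.outcome I.start σ) I.leader

/-! ### Encoding of the instances by finite data -/

/-- A rational number is encoded by the numerator and the denominator of its reduced fraction. -/
abbrev RatCode := ℤ × ℕ

/-- Owners of the vertices, adjacency matrix, one reward matrix for each player, discount factor. -/
abbrev GameCode := List ℕ × List (List Bool) × List (List (List RatCode)) × RatCode

/-- Initial state, table of the transitions `(p, u, q)`, table of the transitions `(p, u, q, v)`. -/
abbrev MachineCode := ℕ × List (List (List Bool)) × List (List (List (List Bool)))

/-- Game, initial vertex, Leader, threshold, machine. -/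
abbrev InstanceCode := GameCode × ℕ × ℕ × RatCode × MachineCode

def encodeRat (r : ℚ) : RatCode := (r.num, r.den)

open Classical in
noncomputable def DSGame.encode {n m : ℕ} (D : DSGame (Fin n) (Fin m)) : GameCode :=
  (List.ofFn fun u => (D.owner u : ℕ),
   List.ofFn fun u => List.ofFn fun v => decide (D.Edge u v),
   List.ofFn fun i => List.ofFn fun u => List.ofFn fun v => encodeRat (D.reward i u v),
   encodeRat D.discount)

open Classical in
noncomputable def Mealy.encode {n m k : ℕ} {G : Game (Fin n) (Fin m)} {i : Fin n}
    (M : Mealy G i (Fin k)) : MachineCode :=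
  ((M.init : ℕ),
   List.ofFn fun p => List.ofFn fun u => List.ofFn fun q => decide (M.silent p u q),
   List.ofFn fun p => List.ofFn fun u => List.ofFn fun q => List.ofFn fun v =>
     decide (M.output p u q v))

noncomputable def Instance.encode {n m k : ℕ} (I : Instance n m k) : InstanceCode :=
  (I.game.encode, (I.start : ℕ), (I.leader : ℕ), encodeRat I.threshold, I.machine.encode)

/-- The `ρ`-rational verification problem in discounted-sum games, as the set of the codes of its
positive instances. -/
def RV (ρ : Rationality) (c : InstanceCode) : Prop :=
  ∃ (n m k : ℕ) (I : Instance n m k), I.encode = c ∧ I.Positive ρ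

/-- The deterministic `ρ`-rational verification problem in discounted-sum games, in which the
machine is required to be deterministic. -/
def DetRV (ρ : Rationality) (c : InstanceCode) : Prop :=
  ∃ (n m k : ℕ) (I : Instance n m k),
    I.encode = c ∧ I.machine.Deterministic ∧ I.Positive ρ

end RationalVerification

/-!
An instance fails to be positive if there is a counterexample: an equilibrium in which Leader
complies with the machine and does not get more than the threshold.  Together with a labelling of
the histories by states that witnesses the compliance, a candidate for a counterexample is a
function from histories to finitely many values, i.e. a point of a compact space.

The counterexamples form a closed subset of this space, and this holds effectively: a point that is
not a counterexample is excluded by finitely many of its values.  This is clear for impossible moves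
and for violations of the transition relation of the machine.  As payoffs are discounted sums, the
payoff of a play is known up to `K λⁿ` from its first `n` steps.  Hence, if Leader gets more than
the threshold, or if a player has a profitable deviation, then finitely many moves of the profile
suffice to see this: those along an initial segment of the outcome, or along initial segments of
the deviating play and of the play deviated from (`Game.isFixedEquilibrium_iff` describes equilibria
by pairs of such plays).  The finite assignments that exclude all of their extensions in this way
(`Code.Forbidden`) are recursively enumerable (`Code.sigmaOne_forbidden`), and an instance is
positive if and only if every point extends one of them (`Instance.positive_iff`).

By compactness, finitely many forbidden assignments then suffice to exclude all points, and these
can be searched for (`SigmaOne.forall_bounded`).  It remains to note that it is decidable whether a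
code is the code of an instance, and whether its machine is deterministic.

Primitive recursiveness is proved by `fun_prop`: the predicates involved are built from the data of
the instance by arithmetic of natural numbers, list operations and bounded quantifiers.
-/

namespace RationalVerification

/-! ### Primitive recursive functions and predicates -/

/-! The closure properties of primitive recursive functions and predicates are stated in the
compositional form that `fun_prop` applies. -/

section Primrec

open Encodable

attribute [fun_prop] Primrec PrimrecPred
attribute [fun_prop] Primrec.id Primrec.const Primrec.comp Primrec.fst Primrec.snd Primrec.pair

variable {α β γ δ : Type*} [Primcodable α] [Primcodable β] [Primcodable γ] [Primcodable δ]

@[fun_prop]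
theorem primrec_prod_fst {f : α → β × γ} (hf : Primrec f) : Primrec fun a => (f a).1 :=
  Primrec.fst.comp hf

@[fun_prop]
theorem primrec_prod_snd {f : α → β × γ} (hf : Primrec f) : Primrec fun a => (f a).2 :=
  Primrec.snd.comp hf

@[fun_prop]
theorem primrec_nat_add {f g : α → ℕ} (hf : Primrec f) (hg : Primrec g) :
    Primrec fun a => f a + g a :=
  Primrec.nat_add.comp hf hg

@[fun_prop]
theorem primrec_nat_sub {f g : α → ℕ} (hf : Primrec f) (hg : Primrec g) :
    Primrec fun a => f a - g a :=
  Primrec.nat_sub.comp hf hg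

@[fun_prop]
theorem primrec_nat_mul {f g : α → ℕ} (hf : Primrec f) (hg : Primrec g) :
    Primrec fun a => f a * g a :=
  Primrec.nat_mul.comp hf hg

@[fun_prop]
theorem primrec_nat_div {f g : α → ℕ} (hf : Primrec f) (hg : Primrec g) :
    Primrec fun a => f a / g a :=
  Primrec.nat_div.comp hf hg

@[fun_prop]
theorem primrec_nat_mod {f g : α → ℕ} (hf : Primrec f) (hg : Primrec g) :
    Primrec fun a => f a % g a :=
  Primrec.nat_mod.comp hf hg

@[fun_prop]
theorem primrec_nat_pow {f g : α → ℕ} (hf : Primrec f) (hg : Primrec g) :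
    Primrec fun a => f a ^ g a :=
  (Primrec₂.unpaired'.1 Nat.Primrec.pow).comp hf hg

@[fun_prop]
theorem primrec_encode {f : α → β} (hf : Primrec f) : Primrec fun a => encode (f a) :=
  Primrec.encode.comp hf

@[fun_prop]
theorem primrec_list_length {f : α → List β} (hf : Primrec f) : Primrec fun a => (f a).length :=
  Primrec.list_length.comp hf

@[fun_prop]
theorem primrec_list_getD {f : α → List β} {g : α → ℕ} {d : β} (hf : Primrec f)
    (hg : Primrec g) : Primrec fun a => (f a).getD (g a) d :=
  (Primrec.list_getD d).comp hf hg

@[fun_prop]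
theorem primrec_list_getElem? {f : α → List β} {g : α → ℕ} (hf : Primrec f)
    (hg : Primrec g) : Primrec fun a => (f a)[g a]? :=
  Primrec.list_getElem?.comp hf hg

@[fun_prop]
theorem primrec_list_append {f g : α → List β} (hf : Primrec f)
    (hg : Primrec g) : Primrec fun a => f a ++ g a :=
  Primrec.list_append.comp hf hg

@[fun_prop]
theorem primrec_list_cons {f : α → β} {g : α → List β} (hf : Primrec f)
    (hg : Primrec g) : Primrec fun a => f a :: g a :=
  Primrec.list_cons.comp hf hg

@[fun_prop]
theorem primrec_list_take {f : α → ℕ} {g : α → List β} (hf : Primrec f)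
    (hg : Primrec g) : Primrec fun a => (g a).take (f a) :=
  Primrec.list_take.comp hf hg

@[fun_prop]
theorem primrec_list_range {f : α → ℕ} (hf : Primrec f) : Primrec fun a => List.range (f a) :=
  Primrec.list_range.comp hf

@[fun_prop]
theorem primrec_list_map {f : α → List β} {g : α → β → γ} (hf : Primrec f)
    (hg : Primrec fun p : α × β => g p.1 p.2) : Primrec fun a => (f a).map (g a) :=
  Primrec.list_map hf hg

@[fun_prop]
theorem primrec_list_flatMap {f : α → List β} {g : α → β → List γ} (hf : Primrec f)
    (hg : Primrec fun p : α × β => g p.1 p.2) : Primrec fun a => (f a).flatMap (g a) :=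
  Primrec.list_flatMap hf hg

theorem primrec_nat_rec {f : α → ℕ} {g : α → β} {h : α → ℕ → β → β} (hf : Primrec f)
    (hg : Primrec g) (hh : Primrec fun p : α × ℕ × β => h p.1 p.2.1 p.2.2) :
    Primrec fun a => (Nat.rec (g a) (h a) (f a) : β) :=
  Primrec.nat_rec' (h := fun a p => h a p.1 p.2) hf hg hh

@[fun_prop]
theorem primrecPred_const (p : Prop) : PrimrecPred fun _ : α => p := by
  classical
  exact Primrec.primrecPred (Primrec.const (decide p))

@[fun_prop]
theorem primrecPred_not {p : α → Prop} (hp : PrimrecPred p) : PrimrecPred fun a => ¬ p a :=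
  hp.not

@[fun_prop]
theorem primrecPred_and {p q : α → Prop} (hp : PrimrecPred p) (hq : PrimrecPred q) :
    PrimrecPred fun a => p a ∧ q a :=
  hp.and hq

@[fun_prop]
theorem primrecPred_or {p q : α → Prop} (hp : PrimrecPred p) (hq : PrimrecPred q) :
    PrimrecPred fun a => p a ∨ q a :=
  hp.or hq

@[fun_prop]
theorem primrecPred_imp {p q : α → Prop} (hp : PrimrecPred p) (hq : PrimrecPred q) :
    PrimrecPred fun a => p a → q a :=
  (hp.not.or hq).of_eq fun _ => imp_iff_not_or.symm

@[fun_prop]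
theorem primrecPred_eq {f g : α → β} (hf : Primrec f) (hg : Primrec g) :
    PrimrecPred fun a => f a = g a :=
  Primrec.eq.comp hf hg

@[fun_prop]
theorem primrecPred_lt {f g : α → ℕ} (hf : Primrec f) (hg : Primrec g) :
    PrimrecPred fun a => f a < g a :=
  Primrec.nat_lt.comp hf hg

@[fun_prop]
theorem primrecPred_le {f g : α → ℕ} (hf : Primrec f) (hg : Primrec g) :
    PrimrecPred fun a => f a ≤ g a :=
  Primrec.nat_le.comp hf hg

@[fun_prop]
theorem primrecPred_forall_mem {f : α → List β} {p : α → β → Prop} (hf : Primrec f)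
    (hp : PrimrecPred fun x : α × β => p x.1 x.2) : PrimrecPred fun a => ∀ b ∈ f a, p a b := by
  have h : PrimrecRel fun (b : β) (a : α) => p a b :=
    hp.comp (Primrec.snd.pair Primrec.fst)
  exact h.forall_mem_list.comp hf Primrec.id

@[fun_prop]
theorem primrecPred_exists_mem {f : α → List β} {p : α → β → Prop} (hf : Primrec f)
    (hp : PrimrecPred fun x : α × β => p x.1 x.2) : PrimrecPred fun a => ∃ b ∈ f a, p a b := by
  have h : PrimrecRel fun (b : β) (a : α) => p a b :=
    hp.comp (Primrec.snd.pair Primrec.fst)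
  exact h.exists_mem_list.comp hf Primrec.id

@[fun_prop]
theorem primrecPred_forall_lt {f : α → ℕ} {p : α → ℕ → Prop} (hf : Primrec f)
    (hp : PrimrecPred fun x : α × ℕ => p x.1 x.2) : PrimrecPred fun a => ∀ b < f a, p a b := by
  have h : PrimrecPred fun a => ∀ b ∈ List.range (f a), p a b := 
    primrecPred_forall_mem (by fun_prop) hp
  exact h.of_eq fun a => by simp

@[fun_prop]
theorem primrecPred_exists_lt {f : α → ℕ} {p : α → ℕ → Prop} (hf : Primrec f)
    (hp : PrimrecPred fun x : α × ℕ => p x.1 x.2) : PrimrecPred fun a => ∃ b < f a, p a b := by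
  have h : PrimrecPred fun a => ∃ b ∈ List.range (f a), p a b := 
    primrecPred_exists_mem (by fun_prop) hp
  exact h.of_eq fun a => by simp

@[fun_prop]
theorem primrecPred_mem {f : α → β} {g : α → List β} (hf : Primrec f) (hg : Primrec g) :
    PrimrecPred fun a => f a ∈ g a := by
  have h : PrimrecPred fun a => ∃ b ∈ g a, b = f a := by fun_prop
  exact h.of_eq fun a => by simp

theorem encode_ofNat_int (n : ℕ) : encode (Int.ofNat n) = 2 * n := rfl

theorem encode_negSucc_int (n : ℕ) : encode (Int.negSucc n) = 2 * n + 1 := rfl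

theorem primrec_int_toNat : Primrec Int.toNat := by
  have h : Primrec fun z : ℤ => (1 - encode z % 2) * (encode z / 2) := by fun_prop
  refine h.of_eq fun z => ?_
  rcases z with n | n
  · rw [encode_ofNat_int]
    simp
  · rw [encode_negSucc_int, show (2 * n + 1) % 2 = 1 by lia]
    simp

theorem primrec_int_neg_toNat : Primrec fun z : ℤ => (-z).toNat := by
  have h : Primrec fun z : ℤ => (encode z % 2) * (encode z / 2 + 1) := by fun_prop
  refine h.of_eq fun z => ?_
  rcases z with n | n
  · rw [encode_ofNat_int]
    simp
  · rw [encode_negSucc_int, show (2 * n + 1) % 2 = 1 by lia, show (2 * n + 1) / 2 = n by lia]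
    simp

@[fun_prop]
theorem primrec_toNat {f : α → ℤ} (hf : Primrec f) : Primrec fun a => (f a).toNat :=
  primrec_int_toNat.comp hf

@[fun_prop]
theorem primrec_neg_toNat {f : α → ℤ} (hf : Primrec f) : Primrec fun a => (-f a).toNat :=
  primrec_int_neg_toNat.comp hf

/-- All words of length `n` over the alphabet `{0, …, b}`. -/
def words (b : ℕ) (n : ℕ) : List (List ℕ) :=
  Nat.rec [[]] (fun _ W => W.flatMap fun w => (List.range (b + 1)).map fun v => w ++ [v]) n

theorem mem_words {b n : ℕ} {w : List ℕ} :
    w ∈ words b n ↔ w.length = n ∧ ∀ v ∈ w, v ≤ b := by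
  induction n generalizing w with
  | zero => simp +contextual [words]
  | succ n ih =>
    have : words b (n + 1) =
        (words b n).flatMap fun w => (List.range (b + 1)).map fun v => w ++ [v] := rfl
    simp only [this, List.mem_flatMap, List.mem_map, List.mem_range, ih]
    constructor
    · rintro ⟨u, ⟨rfl, hu⟩, v, hv, rfl⟩
      refine ⟨by simp, fun a ha => ?_⟩
      rcases List.mem_append.1 ha with ha | ha
      · exact hu a ha
      · simp only [List.mem_singleton] at ha
        lia
    · rintro ⟨hl, hw⟩
      rcases List.eq_nil_or_concat' w with rfl | ⟨u, v, rfl⟩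
      · simp at hl
      · refine ⟨u, ⟨by simpa using hl, fun a ha => hw a (by simp [ha])⟩, v, ?_, rfl⟩
        have := hw v (by simp)
        lia

@[fun_prop]
theorem primrec_words {f g : α → ℕ} (hf : Primrec f) (hg : Primrec g) :
    Primrec fun a => words (f a) (g a) := by
  unfold words
  refine primrec_nat_rec hg (by fun_prop) ?_
  fun_prop

end Primrec

/-! ### Projections of primitive recursive predicates -/

section SigmaOne

open Encodable

variable {α β : Type*} [Primcodable α] [Primcodable β]

/-- Projections of primitive recursive predicates.  They are exactly the recursively enumerable
predicates; only one of the two inclusions is needed here. -/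
def SigmaOne (p : α → Prop) : Prop :=
  ∃ q : α × ℕ → Prop, PrimrecPred q ∧ ∀ a, p a ↔ ∃ n, q (a, n)

theorem SigmaOne.of_eq {p q : α → Prop} (hp : SigmaOne p) (h : ∀ a, p a ↔ q a) : SigmaOne q := by
  obtain rfl : p = q := funext fun a => propext (h a)
  exact hp

theorem SigmaOne.of_primrecPred {p : α → Prop} (hp : PrimrecPred p) : SigmaOne p :=
  ⟨fun x => p x.1, hp.comp Primrec.fst, fun a => by simp⟩

theorem SigmaOne.exists {p : α → β → Prop} (hp : SigmaOne fun x : α × β => p x.1 x.2) :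
    SigmaOne fun a => ∃ b, p a b := by
  obtain ⟨q, hq, h⟩ := hp
  have hd : Primrec fun x : α × ℕ => (decode (α := β × ℕ) x.2).toList :=
    Primrec.optionToList.comp (Primrec.decode.comp Primrec.snd)
  refine ⟨fun x => ∃ y ∈ (decode (α := β × ℕ) x.2).toList, q ((x.1, y.1), y.2),
    primrecPred_exists_mem hd (hq.comp (by fun_prop)), fun a => ?_⟩
  simp only [Option.mem_toList]
  constructor
  · rintro ⟨b, hb⟩
    obtain ⟨n, hn⟩ := (h (a, b)).1 hb
    exact ⟨encode (b, n), (b, n), encodek _, hn⟩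
  · rintro ⟨_, ⟨b, n⟩, _, hn⟩
    exact ⟨b, (h (a, b)).2 ⟨n, hn⟩⟩

theorem SigmaOne.or {p q : α → Prop} (hp : SigmaOne p) (hq : SigmaOne q) :
    SigmaOne fun a => p a ∨ q a := by
  obtain ⟨p', hp', h⟩ := hp
  obtain ⟨q', hq', h'⟩ := hq
  exact ⟨fun x => p' x ∨ q' x, by fun_prop, fun a => by simp only [h, h', exists_or]⟩

theorem SigmaOne.and_primrecPred {p q : α → Prop} (hp : SigmaOne p) (hq : PrimrecPred q) :
    SigmaOne fun a => p a ∧ q a := by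
  obtain ⟨p', hp', h⟩ := hp
  exact ⟨fun x => p' x ∧ q x.1, hp'.and (hq.comp Primrec.fst),
    fun a => by simp only [h, exists_and_right]⟩

theorem SigmaOne.rePred {p : α → Prop} (hp : SigmaOne p) : REPred p := by
  obtain ⟨q, ⟨hd, hq⟩, h⟩ := hp
  have hr : Partrec fun a => Nat.rfind fun n => (Part.some (decide (q (a, n))) : Part Bool) :=
    Partrec.rfind (p := fun a n => (Part.some (decide (q (a, n))) : Part Bool))
      (Computable.partrec (hq.to_comp))
  refine hr.dom_re.of_eq fun a => ?_
  rw [h]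
  refine Nat.rfind_dom.trans ?_
  simp

/-- Effective compactness of spaces of bounded functions: if the finite assignments `T` with
`F (a, T)` are recursively enumerable, then so is the property of `a` that the cylinders of these
assignments cover the functions bounded by `b a`. -/
theorem SigmaOne.forall_bounded {ι : Type*} [Primcodable ι] {F : α × List (ι × ℕ) → Prop}
    (hF : SigmaOne F) {b : α → ℕ} (hb : Primrec b) :
    SigmaOne fun a => ∀ x : ι → ℕ, (∀ i, x i ≤ b a) → ∃ T, F (a, T) ∧ ∀ e ∈ T, x e.1 = e.2 := by
  obtain ⟨q, hq, h⟩ := hF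
  -- a finite subcover, together with a bound for the codes of the indices that occur in it
  have key : PrimrecPred fun y : α × List (List (ι × ℕ) × ℕ) × ℕ =>
      (∀ d ∈ y.2.1, q ((y.1, d.1), d.2)) ∧
        ∀ w ∈ words (b y.1) y.2.2, ∃ d ∈ y.2.1, ∀ e ∈ d.1, w[encode e.1]? = some e.2 := by
    have hs := Primrec.option_some (α := ℕ)
    refine primrecPred_and (primrecPred_forall_mem (by fun_prop) (hq.comp (by fun_prop))) ?_
    fun_prop
  refine (SigmaOne.exists (p := fun a (y : List (List (ι × ℕ) × ℕ) × ℕ) =>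
      (∀ d ∈ y.1, q ((a, d.1), d.2)) ∧
        ∀ w ∈ words (b a) y.2, ∃ d ∈ y.1, ∀ e ∈ d.1, w[encode e.1]? = some e.2)
    (SigmaOne.of_primrecPred key)).of_eq fun a => ?_
  constructor
  · rintro ⟨⟨D, N⟩, hD, hN⟩ x hx
    obtain ⟨d, hd, hdx⟩ := hN
      ((List.range N).map fun j => ((decode (α := ι) j).map x).getD 0) <| by
      refine mem_words.2 ⟨by simp, ?_⟩
      simp only [List.mem_map, List.mem_range]
      rintro _ ⟨j, _, rfl⟩
      cases decode (α := ι) j <;> simp [hx]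
    refine ⟨d.1, (h _).2 ⟨d.2, hD d hd⟩, fun e he => ?_⟩
    have := hdx e he
    simp only [List.getElem?_map, Option.map_eq_some_iff] at this
    obtain ⟨j, hj, hje⟩ := this
    obtain ⟨_, rfl⟩ := List.getElem?_eq_some_iff.1 hj
    simpa using hje
  · intro H
    let U : {d : List (ι × ℕ) × ℕ // q ((a, d.1), d.2)} → Set (ι → ℕ) :=
      fun d => {x | ∀ e ∈ d.1.1, x e.1 = e.2}
    have hU : ∀ d, IsOpen (U d) := by
      intro d
      have : U d = ⋂ e ∈ {e | e ∈ d.1.1}, {x | x e.1 = e.2} := by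
        ext x
        simp [U]
      rw [this]
      refine (List.finite_toSet d.1.1).isOpen_biInter fun e _ => ?_
      have hc : Continuous fun x : ι → ℕ => x e.1 := continuous_apply e.1
      exact (isOpen_discrete ({e.2} : Set ℕ)).preimage hc
    have hK : IsCompact (Set.univ.pi fun _ : ι => Set.Iic (b a)) :=
      isCompact_univ_pi fun _ => (Set.finite_Iic _).isCompact
    obtain ⟨D, hD⟩ := hK.elim_finite_subcover U hU fun x hx => by
      obtain ⟨T, hT, hxT⟩ := H x fun i => hx i trivial
      obtain ⟨n, hn⟩ := (h _).1 hT
      exact Set.mem_iUnion.2 ⟨⟨(T, n), hn⟩, hxT⟩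
    let D' : List (List (ι × ℕ) × ℕ) := D.toList.map Subtype.val
    let c : List ℕ := D'.flatMap fun d => d.1.map fun e => encode e.1
    have hc : ∀ d ∈ D', ∀ e ∈ d.1, encode e.1 < c.sum + 1 := fun d hd e he =>
      Nat.lt_succ_of_le <| List.le_sum_of_mem <| List.mem_flatMap.2
        ⟨d, hd, List.mem_map.2 ⟨e, he, rfl⟩⟩
    refine ⟨(D', c.sum + 1), fun d hd => ?_, fun w hw => ?_⟩
    · obtain ⟨d', _, rfl⟩ := List.mem_map.1 hd
      exact d'.2
    · obtain ⟨hwl, hwb⟩ := mem_words.1 hw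
      have := hD (show (fun i => w.getD (encode i) 0) ∈ _ by
        intro i _
        by_cases hi : encode i < w.length
        · simpa [List.getD_eq_getElem?_getD, hi] using hwb _ (List.getElem_mem hi)
        · simp [List.getD_eq_getElem?_getD, List.getElem?_eq_none (not_lt.1 hi)])
      simp only [Set.mem_iUnion] at this
      obtain ⟨d, hdD, hd⟩ := this
      refine ⟨d.1, List.mem_map.2 ⟨d, by simpa using hdD, rfl⟩, fun e he => ?_⟩
      have he' := hc d.1 (List.mem_map.2 ⟨d, by simpa using hdD, rfl⟩) e he
      have hd' := hd e he
      replace he' : encode e.1 < w.length := hwl.symm ▸ he'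
      rw [List.getElem?_eq_getElem he']
      simpa [List.getD_eq_getElem?_getD, he'] using hd'

end SigmaOne

/-! ### Plays and deviations -/

section Plays

variable {P V : Type*}

/-- The list of the first `n` terms of a sequence. -/
def initialSegment (π : ℕ → V) (n : ℕ) : List V := (List.range n).map π

@[simp]
theorem initialSegment_zero (π : ℕ → V) : initialSegment π 0 = [] := rfl

theorem initialSegment_succ (π : ℕ → V) (n : ℕ) :
    initialSegment π (n + 1) = initialSegment π n ++ [π n] := by
  simp [initialSegment, List.range_succ]

@[simp]
theorem length_initialSegment (π : ℕ → V) (n : ℕ) : (initialSegment π n).length = n := by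
  simp [initialSegment]

@[simp]
theorem getElem_initialSegment (π : ℕ → V) (n j : ℕ) (hj : j < (initialSegment π n).length) :
    (initialSegment π n)[j] = π j := by
  simp [initialSegment]

theorem initialSegment_congr {π π' : ℕ → V} {n : ℕ} (h : ∀ j < n, π j = π' j) :
    initialSegment π n = initialSegment π' n :=
  List.map_congr_left fun j hj => h j (List.mem_range.1 hj)

theorem eq_of_initialSegment_eq {π π' : ℕ → V} {n : ℕ}
    (h : initialSegment π n = initialSegment π' n) {j : ℕ} (hj : j < n) : π j = π' j := by
  have := congrArg (·[j]?) h
  simpa [initialSegment, hj] using this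

theorem take_initialSegment (π : ℕ → V) {n j : ℕ} (hj : j ≤ n) :
    (initialSegment π n).take j = initialSegment π j := by
  simp [initialSegment, ← List.map_take, List.take_range, hj]

theorem prepend_of_lt {h : List V} {π : ℕ → V} {j : ℕ} (hj : j < h.length) :
    prepend h π j = h[j] := by
  simp [prepend, hj]

theorem prepend_add (h : List V) (π : ℕ → V) (k : ℕ) : prepend h π (h.length + k) = π k := by
  simp [prepend]

theorem prepend_length (h : List V) (π : ℕ → V) : prepend h π h.length = π 0 :=
  prepend_add h π 0

theorem prepend_nil (π : ℕ → V) : prepend [] π = π := by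
  funext n
  simp [prepend]

theorem initialSegment_prepend (h : List V) (π : ℕ → V) (k : ℕ) :
    initialSegment (prepend h π) (h.length + k) = h ++ initialSegment π k := by
  refine List.ext_getElem (by simp) fun j h₁ h₂ => ?_
  rw [getElem_initialSegment]
  rcases lt_or_ge j h.length with hj | hj
  · rw [List.getElem_append_left hj, prepend_of_lt hj]
  · obtain ⟨i, rfl⟩ := Nat.exists_eq_add_of_le hj
    rw [prepend_add, List.getElem_append_right (by lia), getElem_initialSegment]
    congr 1
    lia

theorem initialSegment_prepend_length (h : List V) (π : ℕ → V) :
    initialSegment (prepend h π) h.length = h := by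
  simpa using initialSegment_prepend h π 0

namespace Game

variable {G : Game P V} {v₀ v : V} {h : List V} {σ τ : P → List V → V → V} {π π' : ℕ → V} {i L : P}

/-- `π` is a play of the game initialized in `v₀`. -/
def IsPlay (G : Game P V) (v₀ : V) (π : ℕ → V) : Prop :=
  π 0 = v₀ ∧ ∀ j, G.Edge (π j) (π (j + 1))

/-- The move that is made along `π` after the history `π₀ … πⱼ` is the one that `σ` prescribes. -/
def Obeys (G : Game P V) (σ : P → List V → V → V) (π : ℕ → V) (j : ℕ) : Prop :=
  π (j + 1) = σ (G.owner (π j)) (initialSegment π j) (π j)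

theorem run_fst (G : Game P V) (v₀ : V) (σ : P → List V → V → V) (n : ℕ) :
    (G.run v₀ σ n).1 = initialSegment (G.outcome v₀ σ) n := by
  induction n with
  | zero => rfl
  | succ n ih => rw [initialSegment_succ, ← ih]; rfl

theorem obeys_outcome (G : Game P V) (v₀ : V) (σ : P → List V → V → V) (n : ℕ) :
    G.Obeys σ (G.outcome v₀ σ) n := by
  rw [Obeys, ← run_fst]
  rfl

theorem outcome_subgame (G : Game P V) (h : List V) (v : V) (τ : P → List V → V → V) :
    (G.subgame h).outcome v τ = G.outcome v τ := by
  have : ∀ n, (G.subgame h).run v τ n = G.run v τ n := fun n => by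
    induction n with
    | zero => rfl
    | succ n ih => simp only [run, ih]; rfl
  funext n
  simp only [outcome, this]

/-- A play is determined by the point from which it obeys a profile. -/
theorem eq_of_obeys {l : ℕ} (hl : ∀ j ≤ l, π j = π' j) (hπ : ∀ j, l ≤ j → G.Obeys σ π j)
    (hπ' : ∀ j, l ≤ j → G.Obeys σ π' j) : π = π' := by
  have key : ∀ n, ∀ j < n, π j = π' j := by
    intro n
    induction n with
    | zero => simp
    | succ n ih =>
      intro j hj
      rcases Nat.lt_succ_iff_lt_or_eq.1 hj with hj | rfl
      · exact ih j hj
      rcases le_or_gt j l with hjl | hjl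
      · exact hl j hjl
      obtain ⟨j, rfl⟩ := Nat.exists_eq_add_of_lt hjl
      rw [hπ _ (by lia), hπ' _ (by lia), ih _ (by lia), initialSegment_congr fun k hk => ih k (by lia)]
  exact funext fun j => key (j + 1) j (by lia)

theorem IsPlay.isHist (hπ : G.IsPlay v₀ π) (n : ℕ) : G.IsHist v₀ (initialSegment π n) (π n) := by
  rw [IsHist, ← initialSegment_succ]
  constructor
  · rw [List.isChain_iff_getElem]
    intro j hj
    simpa using hπ.2 j
  · rw [List.head?_eq_getElem?]
    simp [initialSegment, hπ.1]

theorem IsHist.append_singleton (hh : G.IsHist v₀ h v) {w : V} (hw : G.Edge v w) :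
    G.IsHist v₀ (h ++ [v]) w := by
  refine ⟨List.isChain_append.2 ⟨hh.1, by simp, ?_⟩, ?_⟩
  · simpa using hw
  · simp only [List.append_assoc]
    have := hh.2
    cases h <;> simpa using this

theorem IsHist.append (hh : G.IsHist v₀ h v) {h' : List V} {w : V} (hw : G.IsHist v h' w) :
    G.IsHist v₀ (h ++ h') w := by
  obtain ⟨h₁, h₂⟩ := hh
  obtain ⟨h₃, h₄⟩ := hw
  rw [IsHist, List.append_assoc]
  constructor
  · rw [List.isChain_append] at h₁ ⊢
    refine ⟨h₁.1, h₃, fun x hx y hy => ?_⟩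
    rw [h₄, Option.mem_some_iff] at hy
    exact h₁.2.2 x hx y (by simp [hy])
  · cases h with
    | nil =>
      simp only [List.nil_append, List.head?_cons, Option.some.injEq] at h₂
      rw [List.nil_append, h₄, h₂]
    | cons a t => simpa using h₂

theorem isHist_nil (G : Game P V) (v : V) : G.IsHist v [] v := ⟨by simp, by simp⟩

theorem IsProfile.isPlay_outcome (hτ : G.IsProfile v τ) : G.IsPlay v (G.outcome v τ) := by
  have hedge : ∀ n, G.IsHist v (initialSegment (G.outcome v τ) n) (G.outcome v τ n) →
      G.Edge (G.outcome v τ n) (G.outcome v τ (n + 1)) := fun n hn => by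
    rw [obeys_outcome G v τ n]
    exact hτ _ _ _ hn rfl
  have hhist : ∀ n, G.IsHist v (initialSegment (G.outcome v τ) n) (G.outcome v τ n) := fun n => by
    induction n with
    | zero => exact isHist_nil G v
    | succ n ih =>
      rw [initialSegment_succ]
      exact ih.append_singleton (hedge n ih)
  exact ⟨rfl, fun n => hedge n (hhist n)⟩

theorem IsHist.isPlay_prepend (hh : G.IsHist v₀ h v) (hπ : G.IsPlay v π) :
    G.IsPlay v₀ (prepend h π) := by
  have hseg : initialSegment (prepend h π) (h.length + 1) = h ++ [v] := by
    rw [initialSegment_prepend, initialSegment_succ, hπ.1]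
    rfl
  obtain ⟨h₁, h₂⟩ := hh
  rw [← hseg] at h₁ h₂
  constructor
  · rw [List.head?_eq_getElem?] at h₂
    simpa [initialSegment] using h₂
  · intro j
    rcases lt_or_ge j h.length with hj | hj
    · rw [List.isChain_iff_getElem] at h₁
      have hedge := h₁ j (by simpa using hj)
      rwa [getElem_initialSegment, getElem_initialSegment] at hedge
    · obtain ⟨k, rfl⟩ := Nat.exists_eq_add_of_le hj
      rw [add_assoc, prepend_add, prepend_add]
      exact hπ.2 k

theorem IsProfile.subprofile (hσ : G.IsProfile v₀ σ) (hh : G.IsHist v₀ h v) :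
    G.IsProfile v (subprofile σ h) :=
  fun i _ _ hh' hv' => hσ i _ _ (hh.append hh') hv'

/-- The play that `σ` generates after the history `hv`. -/
def continuation (G : Game P V) (σ : P → List V → V → V) (h : List V) (v : V) : ℕ → V :=
  prepend h (G.outcome v (Game.subprofile σ h))

theorem IsProfile.isPlay_continuation (hσ : G.IsProfile v₀ σ) (hh : G.IsHist v₀ h v) :
    G.IsPlay v₀ (G.continuation σ h v) :=
  hh.isPlay_prepend (hσ.subprofile hh).isPlay_outcome

theorem initialSegment_continuation (G : Game P V) (σ : P → List V → V → V) (h : List V) (v : V) :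
    initialSegment (G.continuation σ h v) h.length = h :=
  initialSegment_prepend_length _ _

theorem continuation_length (G : Game P V) (σ : P → List V → V → V) (h : List V) (v : V) :
    G.continuation σ h v h.length = v :=
  prepend_length _ _

theorem obeys_continuation (G : Game P V) (σ : P → List V → V → V) (h : List V) (v : V) {j : ℕ}
    (hj : h.length ≤ j) : G.Obeys σ (G.continuation σ h v) j := by
  obtain ⟨k, rfl⟩ := Nat.exists_eq_add_of_le hj
  rw [Obeys, continuation, add_assoc, prepend_add, prepend_add, initialSegment_prepend,
    obeys_outcome G v _ k]
  rfl

theorem continuation_nil (G : Game P V) (σ : P → List V → V → V) (v : V) :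
    G.continuation σ [] v = G.outcome v σ :=
  prepend_nil _

theorem histCompatible_initialSegment (G : Game P V) (L : P) (s : List V → V → V) (π : ℕ → V)
    (n : ℕ) :
    G.HistCompatible L s (initialSegment π n) (π n) ↔
      ∀ j < n, G.owner (π j) = L → π (j + 1) = s (initialSegment π j) (π j) := by
  rw [HistCompatible, ← initialSegment_succ]
  constructor
  · intro H j hj hL
    refine H _ _ _ ((initialSegment π (n + 1)).drop (j + 2)) ?_ hL
    conv_lhs => rw [← List.take_append_drop (j + 2) (initialSegment π (n + 1))]
    rw [take_initialSegment π (by lia), initialSegment_succ, initialSegment_succ]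
    simp
  · intro H a u w b hab hL
    have hlen := congrArg List.length hab
    simp only [length_initialSegment, List.length_append, List.length_cons] at hlen
    have ha : initialSegment π a.length = a := by
      rw [← take_initialSegment π (n := n + 1) (by lia), hab]
      simp
    have hu : π a.length = u := by
      have := congrArg (·[a.length]?) hab
      simpa [initialSegment, show a.length < n + 1 by lia] using this
    have hw : π (a.length + 1) = w := by
      have := congrArg (·[a.length + 1]?) hab
      simpa [initialSegment, show a.length < n by lia] using this
    have := H a.length (by lia) (by rw [hu, hL])
    rwa [ha, hu, hw] at this

variable [DecidableEq P]

/-- The plays that arise when player `i` deviates from `σ` after the history `hv` are the plays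
through `hv` in which all other players move from then on as `σ` prescribes. -/
theorem exists_deviation_iff (hσ : G.IsProfile v₀ σ) (hh : G.IsHist v₀ h v) {ρ : ℕ → V} :
    (∃ s, G.IsStrategy v i s ∧
        prepend h (G.outcome v (Function.update (Game.subprofile σ h) i s)) = ρ) ↔
      G.IsPlay v₀ ρ ∧ initialSegment ρ h.length = h ∧ ρ h.length = v ∧
        ∀ j, h.length ≤ j → G.owner (ρ j) ≠ i → G.Obeys σ ρ j := by
  constructor
  · rintro ⟨s, hs, rfl⟩
    have hp : G.IsProfile v (Function.update (Game.subprofile σ h) i s) := by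
      intro k
      rcases eq_or_ne k i with rfl | hk
      · simpa using hs
      · simpa [hk] using hσ.subprofile hh k
    refine ⟨hh.isPlay_prepend hp.isPlay_outcome, initialSegment_prepend_length _ _,
      prepend_length _ _, fun j hj hji => ?_⟩
    obtain ⟨k, rfl⟩ := Nat.exists_eq_add_of_le hj
    rw [prepend_add] at hji
    rw [Obeys, add_assoc, prepend_add, prepend_add, initialSegment_prepend, obeys_outcome,
      Function.update_of_ne hji]
    rfl
  · rintro ⟨hρ, hseg, hv, hob⟩
    classical
    -- follow `ρ` as long as the history is an initial segment of `ρ`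
    let s : List V → V → V := fun h' v' =>
      if h ++ h' ++ [v'] = initialSegment ρ (h.length + h'.length + 1) then
        ρ (h.length + h'.length + 1) else σ i (h ++ h') v'
    refine ⟨s, fun h' v' hh' hi => ?_, ?_⟩
    · by_cases hc : h ++ h' ++ [v'] = initialSegment ρ (h.length + h'.length + 1)
      · have hv' : v' = ρ (h.length + h'.length) := by
          have := congrArg (·[h.length + h'.length]?) hc
          simpa [initialSegment, ← List.append_assoc] using this
        have hs : s h' v' = ρ (h.length + h'.length + 1) := if_pos hc
        rw [hs, hv']
        exact hρ.2 _
      · simp only [s, if_neg hc]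
        exact hσ i _ _ (hh.append hh') hi
    · have key : ∀ k, ∀ j ≤ k,
          G.outcome v (Function.update (Game.subprofile σ h) i s) j = ρ (h.length + j) := by
        intro k
        induction k with
        | zero =>
          intro j hj
          obtain rfl : j = 0 := by lia
          exact hv.symm
        | succ k ih =>
          intro j hj
          rcases Nat.le_succ_iff.1 hj with hj | rfl
          · exact ih j hj
          have hk : h ++ initialSegment
              (G.outcome v (Function.update (Game.subprofile σ h) i s)) k =
              initialSegment ρ (h.length + k) := by
            rw [initialSegment_congr fun j hj => ih j hj.le]
            conv_lhs => lhs; rw [← hseg]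
            simp only [initialSegment, List.range_add, List.map_append, List.map_map]
            rfl
          rw [obeys_outcome, ih k le_rfl]
          by_cases hi : G.owner (ρ (h.length + k)) = i
          · simp only [hi, Function.update_self, s]
            rw [if_pos]
            · simp [add_assoc]
            · rw [hk, length_initialSegment, initialSegment_succ]
          · rw [Function.update_of_ne hi, Game.subprofile, hk]
            exact (hob _ (by lia) hi).symm
      rw [← prepend_nil ρ]
      funext n
      rcases lt_or_ge n h.length with hn | hn
      · rw [prepend_of_lt hn, prepend_nil]
        have := congrArg (·[n]?) hseg
        simpa [initialSegment, hn] using this.symm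
      · obtain ⟨k, rfl⟩ := Nat.exists_eq_add_of_le hn
        rw [prepend_add, key k k le_rfl, prepend_nil]

/-- Nash equilibria of a subgame in terms of plays of the whole game. -/
theorem isFixedNE_subgame_iff (hσ : G.IsProfile v₀ σ) (hh : G.IsHist v₀ h v) :
    (G.subgame h).IsFixedNE v L (Game.subprofile σ h) ↔
      ∀ i, i ≠ L → ∀ ρ, G.IsPlay v₀ ρ → initialSegment ρ h.length = h → ρ h.length = v →
        (∀ j, h.length ≤ j → G.owner (ρ j) ≠ i → G.Obeys σ ρ j) →
        G.payoff ρ i ≤ G.payoff (G.continuation σ h v) i := by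
  simp only [IsFixedNE, outcome_subgame]
  refine forall_congr' fun i => forall_congr' fun _ => ⟨fun H ρ h₁ h₂ h₃ h₄ => ?_, fun H s hs => ?_⟩
  · obtain ⟨s, hs, rfl⟩ := (exists_deviation_iff hσ hh).2 ⟨h₁, h₂, h₃, h₄⟩
    exact H s hs
  · obtain ⟨h₁, h₂, h₃, h₄⟩ := (exists_deviation_iff hσ hh).1 ⟨s, hs, rfl⟩
    exact H _ h₁ h₂ h₃ h₄

/-- `ρ` and `ρ'` are plays that agree up to position `l` and in which Leader always moves as `σ`
prescribes; after position `l`, all players do so in `ρ'`, and all players but `i` do so in `ρ`. -/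
structure IsDeviation (G : Game P V) (v₀ : V) (L : P) (σ : P → List V → V → V) (l : ℕ) (i : P)
    (ρ ρ' : ℕ → V) : Prop where
  ne : i ≠ L
  isPlay : G.IsPlay v₀ ρ
  isPlay' : G.IsPlay v₀ ρ'
  agree : ∀ j ≤ l, ρ j = ρ' j
  obeys : ∀ j, G.owner (ρ j) = L ∨ l ≤ j ∧ G.owner (ρ j) ≠ i → G.Obeys σ ρ j
  obeys' : ∀ j, G.owner (ρ' j) = L ∨ l ≤ j → G.Obeys σ ρ' j

theorem isFixedSPE_iff (hσ : G.IsProfile v₀ σ) :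
    G.IsFixedSPE v₀ L σ ↔
      ∀ l i ρ ρ', G.IsDeviation v₀ L σ l i ρ ρ' → G.payoff ρ i ≤ G.payoff ρ' i := by
  constructor
  · intro H l i ρ ρ' D
    have hh := D.isPlay.isHist l
    have hρ' : ρ' = G.continuation σ (initialSegment ρ l) (ρ l) := by
      refine eq_of_obeys (l := l) (fun j hj => ?_) (fun j hj => D.obeys' j (.inr hj))
        fun j hj => obeys_continuation _ _ _ _ (by simpa using hj)
      rw [← D.agree j hj]
      rcases hj.lt_or_eq with hj | rfl
      · have := initialSegment_continuation G σ (initialSegment ρ l) (ρ l)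
        rw [length_initialSegment] at this
        exact (eq_of_initialSegment_eq this hj).symm
      · simpa using (continuation_length G σ (initialSegment ρ j) (ρ j)).symm
    rw [hρ']
    refine (isFixedNE_subgame_iff hσ hh).1 (H _ _ hh ?_) i D.ne ρ D.isPlay (by simp) (by simp) ?_
    · rw [histCompatible_initialSegment]
      intro j _ hL
      have := D.obeys j (.inl hL)
      rwa [Obeys, hL] at this
    · intro j hj hji
      exact D.obeys j (.inr ⟨by simpa using hj, hji⟩)
  · intro H h v hh hc
    rw [isFixedNE_subgame_iff hσ hh]
    intro i hi ρ hρ hseg hv hob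
    have hagree : ∀ j ≤ h.length, ρ j = G.continuation σ h v j := by
      intro j hj
      rcases hj.lt_or_eq with hj | rfl
      · exact eq_of_initialSegment_eq (hseg.trans (initialSegment_continuation G σ h v).symm) hj
      · rw [hv, continuation_length]
    have hL : ∀ j < h.length, G.owner (ρ j) = L → G.Obeys σ ρ j := by
      have hc' : G.HistCompatible L (σ L) (initialSegment ρ h.length) (ρ h.length) := by
        rwa [hseg, hv]
      intro j hj hjL
      rw [Obeys, hjL]
      exact (histCompatible_initialSegment G L _ ρ _).1 hc' j hj hjL
    refine H h.length i ρ _ ⟨hi, hρ, hσ.isPlay_continuation hh, hagree, fun j hj => ?_,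
      fun j hj => ?_⟩
    · rcases lt_or_ge j h.length with hjl | hjl
      · exact hL j hjl (hj.resolve_right fun h => by lia)
      · refine hob j hjl ?_
        rcases hj with hj | hj
        · rw [hj]
          exact hi.symm
        · exact hj.2
    · rcases lt_or_ge j h.length with hjl | hjl
      · have hjL := hj.resolve_right (by lia)
        have := hL j hjl (by rwa [hagree j hjl.le])
        rw [Obeys] at this ⊢
        rw [← hagree j hjl.le, ← hagree (j + 1) hjl,
          ← initialSegment_congr fun k hk => hagree k (by lia)]
        exact this
      · exact obeys_continuation _ _ _ _ hjl

theorem isFixedNE_iff (hσ : G.IsProfile v₀ σ) :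
    G.IsFixedNE v₀ L σ ↔
      ∀ i ρ ρ', G.IsDeviation v₀ L σ 0 i ρ ρ' → G.payoff ρ i ≤ G.payoff ρ' i := by
  have hsub : G.IsFixedNE v₀ L σ ↔ (G.subgame []).IsFixedNE v₀ L (Game.subprofile σ []) := by
    have : G.subgame [] = G := by
      simp only [subgame, prepend_nil]
    rw [this]
    rfl
  rw [hsub, isFixedNE_subgame_iff hσ (isHist_nil G v₀), continuation_nil]
  have hout : G.IsPlay v₀ (G.outcome v₀ σ) := hσ.isPlay_outcome
  constructor
  · intro H i ρ ρ' D
    have : ρ' = G.outcome v₀ σ := by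
      refine eq_of_obeys (l := 0) (fun j hj => ?_) (fun j hj => D.obeys' j (.inr hj))
        fun j _ => obeys_outcome _ _ _ j
      obtain rfl : j = 0 := by lia
      exact D.isPlay'.1
    rw [this]
    exact H i D.ne ρ D.isPlay rfl D.isPlay.1 fun j hj hji => D.obeys j (.inr ⟨hj, hji⟩)
  · intro H i hi ρ hρ _ hv hob
    refine H i ρ _ ⟨hi, hρ, hout, fun j hj => ?_, fun j hj => hob j (by simp) ?_,
      fun j _ => obeys_outcome _ _ _ j⟩
    · obtain rfl : j = 0 := by lia
      exact hv
    · rcases hj with hj | hj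
      · rw [hj]
        exact hi.symm
      · exact hj.2

/-- Equilibria in terms of plays: for Nash equilibria, only deviations from the start count. -/
theorem isFixedEquilibrium_iff (hσ : G.IsProfile v₀ σ) (r : Rationality) :
    G.IsFixedEquilibrium r v₀ L σ ↔
      ∀ l i ρ ρ', (r = .nash → l = 0) → G.IsDeviation v₀ L σ l i ρ ρ' →
        G.payoff ρ i ≤ G.payoff ρ' i := by
  cases r with
  | nash =>
    refine (isFixedNE_iff hσ).trans ⟨fun H l i ρ ρ' hl => ?_, fun H i ρ ρ' => H 0 i ρ ρ' fun _ => rfl⟩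
    rw [hl rfl]
    exact H i ρ ρ'
  | subgamePerfect => simpa [IsFixedEquilibrium] using isFixedSPE_iff hσ

end Game

end Plays

/-! ### Fractions of natural numbers -/

/-- The triple `(x, y, d)` of natural numbers stands for the number `(x - y) / d`.  All operations
are polynomials in natural numbers, so that their primitive recursiveness is immediate; fractions
are not reduced. -/
abbrev Frac := ℕ × ℕ × ℕ

namespace Frac

/-- The number that a triple stands for. -/
noncomputable def val (a : Frac) : ℝ := ((a.1 : ℝ) - a.2.1) / a.2.2

/-- Addition of the values, for positive denominators. -/
def add (a b : Frac) : Frac :=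
  (a.1 * b.2.2 + b.1 * a.2.2, a.2.1 * b.2.2 + b.2.1 * a.2.2, a.2.2 * b.2.2)

/-- Multiplication of the values. -/
def mul (a b : Frac) : Frac :=
  (a.1 * b.1 + a.2.1 * b.2.1, a.1 * b.2.1 + a.2.1 * b.1, a.2.2 * b.2.2)

/-- Powers of `a`, for `a = (x, 0, d)`. -/
def pow (a : Frac) (n : ℕ) : Frac := (a.1 ^ n, 0, a.2.2 ^ n)

/-- Comparison of the values, for positive denominators. -/
def Lt (a b : Frac) : Prop := a.1 * b.2.2 + b.2.1 * a.2.2 < b.1 * a.2.2 + a.2.1 * b.2.2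

/-- Comparison of the values, for positive denominators. -/
def Le (a b : Frac) : Prop := a.1 * b.2.2 + b.2.1 * a.2.2 ≤ b.1 * a.2.2 + a.2.1 * b.2.2

/-- The natural number `n` as a fraction. -/
def ofNat (n : ℕ) : Frac := (n, 0, 1)

/-- The rational number with code `r` as a fraction. -/
def ofRatCode (r : RatCode) : Frac := (r.1.toNat, (-r.1).toNat, r.2)

/-- The discounted sum of the first `n` terms of `r`. -/
def discountedSum (lam : Frac) (r : ℕ → Frac) (n : ℕ) : Frac :=
  Nat.rec (ofNat 0) (fun j s => s.add ((lam.pow j).mul (r j))) n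

variable {a b : Frac}

theorem val_add (ha : 0 < a.2.2) (hb : 0 < b.2.2) : (a.add b).val = a.val + b.val := by
  have : (a.2.2 : ℝ) ≠ 0 := by positivity
  have : (b.2.2 : ℝ) ≠ 0 := by positivity
  simp only [val, add]
  push_cast
  field_simp
  ring

theorem val_mul : (a.mul b).val = a.val * b.val := by
  simp only [val, mul]
  push_cast
  rw [div_mul_div_comm]
  ring

theorem val_pow (ha : a.2.1 = 0) (n : ℕ) : (a.pow n).val = a.val ^ n := by
  simp [val, pow, ha, div_pow]

theorem lt_iff (ha : 0 < a.2.2) (hb : 0 < b.2.2) : a.Lt b ↔ a.val < b.val := by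
  have ha' : (0 : ℝ) < a.2.2 := by positivity
  have hb' : (0 : ℝ) < b.2.2 := by positivity
  rw [val, val, div_lt_div_iff₀ ha' hb', Lt, ← Nat.cast_lt (α := ℝ)]
  push_cast
  constructor <;> intro h <;> linarith

theorem le_iff (ha : 0 < a.2.2) (hb : 0 < b.2.2) : a.Le b ↔ a.val ≤ b.val := by
  have ha' : (0 : ℝ) < a.2.2 := by positivity
  have hb' : (0 : ℝ) < b.2.2 := by positivity
  rw [val, val, div_le_div_iff₀ ha' hb', Le, ← Nat.cast_le (α := ℝ)]
  push_cast
  constructor <;> intro h <;> linarith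

theorem val_ofNat (n : ℕ) : (ofNat n).val = n := by simp [val, ofNat]

theorem val_ofRatCode (q : ℚ) : (ofRatCode (encodeRat q)).val = q := by
  have h : (q.num.toNat : ℝ) - ((-q.num).toNat : ℝ) = q.num := by
    have : (q.num.toNat : ℤ) - ((-q.num).toNat : ℤ) = q.num := by lia
    exact_mod_cast this
  have h' : (q.num : ℝ) / q.den = q := by exact_mod_cast Rat.num_div_den q
  rw [← h', ← h]
  simp [val, ofRatCode, encodeRat]

theorem den_pow_pos (ha : 0 < a.2.2) (n : ℕ) : 0 < (a.pow n).2.2 := Nat.pow_pos ha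

theorem den_mul_pos (ha : 0 < a.2.2) (hb : 0 < b.2.2) : 0 < (a.mul b).2.2 := Nat.mul_pos ha hb

theorem den_add_pos (ha : 0 < a.2.2) (hb : 0 < b.2.2) : 0 < (a.add b).2.2 := Nat.mul_pos ha hb

theorem den_ofRatCode_pos (q : ℚ) : 0 < (ofRatCode (encodeRat q)).2.2 := q.den_pos

theorem discountedSum_spec {lam : Frac} {r : ℕ → Frac} (h : 0 < lam.2.2) (h' : lam.2.1 = 0) (n : ℕ)
    (hr : ∀ j < n, 0 < (r j).2.2) :
    0 < (discountedSum lam r n).2.2 ∧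
      (discountedSum lam r n).val = ∑ j ∈ Finset.range n, lam.val ^ j * (r j).val := by
  induction n with
  | zero => exact ⟨one_pos, by simp [discountedSum, val_ofNat]⟩
  | succ n ih =>
    obtain ⟨h₁, h₂⟩ := ih fun j hj => hr j (by lia)
    have hm := den_mul_pos (den_pow_pos h n) (hr n (by lia))
    refine ⟨den_add_pos h₁ hm, ?_⟩
    rw [Finset.sum_range_succ, ← h₂, ← val_pow h', ← val_mul]
    exact val_add h₁ hm

section

variable {α : Type*} [Primcodable α] {f g : α → Frac} {n : α → ℕ}

@[fun_prop]
theorem primrec_add (hf : Primrec f) (hg : Primrec g) : Primrec fun a => (f a).add (g a) := by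
  unfold add
  fun_prop

@[fun_prop]
theorem primrec_mul (hf : Primrec f) (hg : Primrec g) : Primrec fun a => (f a).mul (g a) := by
  unfold mul
  fun_prop

@[fun_prop]
theorem primrec_pow (hf : Primrec f) (hn : Primrec n) : Primrec fun a => (f a).pow (n a) := by
  unfold pow
  fun_prop

@[fun_prop]
theorem primrec_ofNat (hn : Primrec n) : Primrec fun a => ofNat (n a) := by
  unfold ofNat
  fun_prop

@[fun_prop]
theorem primrec_ofRatCode {r : α → RatCode} (hr : Primrec r) :
    Primrec fun a => ofRatCode (r a) := by
  unfold ofRatCode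
  fun_prop

@[fun_prop]
theorem primrecPred_lt (hf : Primrec f) (hg : Primrec g) :
    PrimrecPred fun a => (f a).Lt (g a) := by
  unfold Lt
  fun_prop

@[fun_prop]
theorem primrecPred_le (hf : Primrec f) (hg : Primrec g) :
    PrimrecPred fun a => (f a).Le (g a) := by
  unfold Le
  fun_prop

@[fun_prop]
theorem primrec_discountedSum {r : α → ℕ → Frac} (hf : Primrec f)
    (hr : Primrec fun p : α × ℕ => r p.1 p.2) (hn : Primrec n) :
    Primrec fun a => discountedSum (f a) (r a) (n a) := by
  unfold discountedSum
  refine primrec_nat_rec hn (by fun_prop) ?_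
  have : Primrec fun p : α × ℕ × Frac => r p.1 p.2.1 :=
    hr.comp (Primrec.fst.pair (Primrec.fst.comp Primrec.snd))
  fun_prop

end

end Frac

/-! ### Discounted sums -/

section DiscountedSum

open Filter Topology

variable {lam : ℝ} {K : ℝ} {a : ℕ → ℝ}

theorem summable_discounted (h0 : 0 < lam) (h1 : lam < 1) (ha : ∀ k, |a k| ≤ K * (1 - lam)) :
    Summable fun k => lam ^ k * a k := by
  refine Summable.of_norm_bounded
    (g := fun k => lam ^ k * (K * (1 - lam)))
    ((summable_geometric_of_lt_one h0.le h1).mul_right _) fun k => ?_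
  rw [norm_mul, Real.norm_eq_abs, Real.norm_eq_abs, abs_of_pos (pow_pos h0 k)]
  exact mul_le_mul_of_nonneg_left (ha k) (pow_pos h0 k).le

/-- If the terms are bounded by `K (1 - λ)`, then the discounted sum of the terms from the `n`-th
one on is bounded by `K λⁿ`. -/
theorem abs_tsum_sub_sum_le (h0 : 0 < lam) (h1 : lam < 1) (ha : ∀ k, |a k| ≤ K * (1 - lam))
    (n : ℕ) :
    |∑' k, lam ^ k * a k - ∑ k ∈ Finset.range n, lam ^ k * a k| ≤ K * lam ^ n := by
  have hs := summable_discounted h0 h1 ha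
  rw [← hs.sum_add_tsum_nat_add n, add_sub_cancel_left, ← Real.norm_eq_abs]
  have hg : HasSum (fun k => lam ^ k * (lam ^ n * (K * (1 - lam))))
      ((1 - lam)⁻¹ * (lam ^ n * (K * (1 - lam)))) :=
    (hasSum_geometric_of_lt_one h0.le h1).mul_right _
  have h1' : 1 - lam ≠ 0 := by linarith
  have : (1 - lam)⁻¹ * (lam ^ n * (K * (1 - lam))) = K * lam ^ n := by
    field_simp
  rw [← this]
  refine tsum_of_norm_bounded hg fun k => ?_
  rw [norm_mul, Real.norm_eq_abs, Real.norm_eq_abs, abs_of_pos (pow_pos h0 _), pow_add, mul_assoc]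
  gcongr
  exact ha _

/-- Adding a multiple of `λⁿ`, such as the error bound, does not change the limit of the partial
sums. -/
theorem tendsto_sum_discounted (h0 : 0 < lam) (h1 : lam < 1) (ha : ∀ k, |a k| ≤ K * (1 - lam))
    (C : ℝ) :
    Tendsto (fun n => ∑ k ∈ Finset.range n, lam ^ k * a k + C * lam ^ n) atTop
      (𝓝 (∑' k, lam ^ k * a k)) := by
  have h := (summable_discounted h0 h1 ha).hasSum.tendsto_sum_nat.add
    ((tendsto_pow_atTop_nhds_zero_of_lt_one h0.le h1).const_mul C)
  simpa using h

end DiscountedSum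

/-! ### Codes of instances -/

namespace Code

/-! The following functions read the data of a code.  Outside of the tables, a default value is
returned, so that they are defined for all codes. -/

/-- The number of vertices. -/
def numVertices (c : InstanceCode) : ℕ := c.1.1.length

/-- The number of players. -/
def numPlayers (c : InstanceCode) : ℕ := c.1.2.2.1.length

/-- The number of states of the machine. -/
def numStates (c : InstanceCode) : ℕ := c.2.2.2.2.2.1.length

/-- The player that controls `u`. -/
def owner (c : InstanceCode) (u : ℕ) : ℕ := c.1.1.getD u 0

/-- Whether `uv` is an edge. -/
def edge (c : InstanceCode) (u v : ℕ) : Bool := (c.1.2.1.getD u []).getD v false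

/-- The reward of player `i` for the edge `uv`. -/
def reward (c : InstanceCode) (i u v : ℕ) : RatCode :=
  ((c.1.2.2.1.getD i []).getD u []).getD v (0, 1)

/-- The discount factor. -/
def discount (c : InstanceCode) : RatCode := c.1.2.2.2

/-- The initial vertex. -/
def start (c : InstanceCode) : ℕ := c.2.1

/-- The player that plays the role of Leader. -/
def leader (c : InstanceCode) : ℕ := c.2.2.1

/-- The threshold. -/
def threshold (c : InstanceCode) : RatCode := c.2.2.2.1

/-- The initial state of the machine. -/
def init (c : InstanceCode) : ℕ := c.2.2.2.2.1

/-- Whether `(p, u, q)` is a transition. -/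
def silent (c : InstanceCode) (p u q : ℕ) : Bool :=
  ((c.2.2.2.2.2.1.getD p []).getD u []).getD q false

/-- Whether `(p, u, q, v)` is a transition. -/
def output (c : InstanceCode) (p u q v : ℕ) : Bool :=
  (((c.2.2.2.2.2.2.getD p []).getD u []).getD q []).getD v false

/-- The code with the same entries whose tables have the right dimensions. -/
def rebuild (c : InstanceCode) : InstanceCode :=
  (((List.range (numVertices c)).map (owner c),
    (List.range (numVertices c)).map fun u => (List.range (numVertices c)).map fun v => edge c u v,
    (List.range (numPlayers c)).map fun i => (List.range (numVertices c)).map fun u =>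
      (List.range (numVertices c)).map fun v => reward c i u v,
    discount c),
   start c, leader c, threshold c, init c,
   (List.range (numStates c)).map fun p => (List.range (numVertices c)).map fun u =>
     (List.range (numStates c)).map fun q => silent c p u q,
   (List.range (numStates c)).map fun p => (List.range (numVertices c)).map fun u =>
     (List.range (numStates c)).map fun q => (List.range (numVertices c)).map fun v =>
       output c p u q v)

/-- `r` is the code of a rational number: its denominator is positive, and every common divisor of
its numerator and its denominator is `1`.  The absolute value of an integer `z` is written as
`z.toNat + (-z).toNat`. -/
def IsReduced (r : RatCode) : Prop :=
  0 < r.2 ∧ ∀ e < r.2 + 1, (r.1.toNat + (-r.1).toNat) % e = 0 → r.2 % e = 0 → e = 1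

/-- The entries of `c` describe a discounted-sum game with an initial vertex, a Leader and a
threshold. -/
def ValidGame (c : InstanceCode) : Prop :=
  (∀ u < numVertices c, owner c u < numPlayers c) ∧
  (∀ u < numVertices c, ∃ v < numVertices c, edge c u v = true) ∧
  (∀ i < numPlayers c, ∀ u < numVertices c, ∀ v < numVertices c, IsReduced (reward c i u v)) ∧
  IsReduced (discount c) ∧ 0 < (discount c).1.toNat ∧ (discount c).1.toNat < (discount c).2 ∧
  start c < numVertices c ∧ leader c < numPlayers c ∧ IsReduced (threshold c)

/-- The entries of `c` describe a Mealy machine for Leader. -/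
def ValidMachine (c : InstanceCode) : Prop :=
  init c < numStates c ∧
  (∀ p < numStates c, ∀ u < numVertices c, ∀ q < numStates c,
    silent c p u q = true → owner c u ≠ leader c) ∧
  (∀ p < numStates c, ∀ u < numVertices c, ∀ q < numStates c, ∀ v < numVertices c,
    output c p u q v = true → owner c u = leader c) ∧
  (∀ p < numStates c, ∀ u < numVertices c, ∀ q < numStates c, ∀ v < numVertices c,
    output c p u q v = true → edge c u v = true) ∧
  ∀ p < numStates c, ∀ u < numVertices c, (∃ q < numStates c, silent c p u q = true) ∨
    ∃ q < numStates c, ∃ v < numVertices c, output c p u q v = true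

/-- `c` is the code of an instance: its tables have the right dimensions and admissible entries. -/
def Valid (c : InstanceCode) : Prop := rebuild c = c ∧ ValidGame c ∧ ValidMachine c

/-- The machine described by the entries of `c` is deterministic. -/
def Deterministic (c : InstanceCode) : Prop :=
  ∀ p < numStates c, ∀ u < numVertices c,
    (owner c u ≠ leader c → ∃ q < numStates c, silent c p u q = true ∧
      ∀ q' < numStates c, silent c p u q' = true → q' = q) ∧
    (owner c u = leader c → ∃ q < numStates c, ∃ v < numVertices c, output c p u q v = true ∧
      ∀ q' < numStates c, ∀ v' < numVertices c, output c p u q' v' = true → q' = q ∧ v' = v)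

section

variable {α : Type*} [Primcodable α] {f : α → InstanceCode} {g₁ g₂ g₃ g₄ : α → ℕ}

@[fun_prop]
theorem primrec_numVertices (hf : Primrec f) : Primrec fun a => numVertices (f a) := by
  unfold numVertices; fun_prop

@[fun_prop]
theorem primrec_numPlayers (hf : Primrec f) : Primrec fun a => numPlayers (f a) := by
  unfold numPlayers; fun_prop

@[fun_prop]
theorem primrec_numStates (hf : Primrec f) : Primrec fun a => numStates (f a) := by
  unfold numStates; fun_prop

@[fun_prop]
theorem primrec_owner (hf : Primrec f) (h₁ : Primrec g₁) :
    Primrec fun a => owner (f a) (g₁ a) := by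
  unfold owner; fun_prop

@[fun_prop]
theorem primrec_edge (hf : Primrec f) (h₁ : Primrec g₁) (h₂ : Primrec g₂) :
    Primrec fun a => edge (f a) (g₁ a) (g₂ a) := by
  unfold edge; fun_prop

@[fun_prop]
theorem primrec_reward (hf : Primrec f) (h₁ : Primrec g₁) (h₂ : Primrec g₂) (h₃ : Primrec g₃) :
    Primrec fun a => reward (f a) (g₁ a) (g₂ a) (g₃ a) := by
  unfold reward; fun_prop

@[fun_prop]
theorem primrec_discount (hf : Primrec f) : Primrec fun a => discount (f a) := by
  unfold discount; fun_prop

@[fun_prop]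
theorem primrec_start (hf : Primrec f) : Primrec fun a => start (f a) := by
  unfold start; fun_prop

@[fun_prop]
theorem primrec_leader (hf : Primrec f) : Primrec fun a => leader (f a) := by
  unfold leader; fun_prop

@[fun_prop]
theorem primrec_threshold (hf : Primrec f) : Primrec fun a => threshold (f a) := by
  unfold threshold; fun_prop

@[fun_prop]
theorem primrec_init (hf : Primrec f) : Primrec fun a => init (f a) := by
  unfold init; fun_prop

@[fun_prop]
theorem primrec_silent (hf : Primrec f) (h₁ : Primrec g₁) (h₂ : Primrec g₂) (h₃ : Primrec g₃) :
    Primrec fun a => silent (f a) (g₁ a) (g₂ a) (g₃ a) := by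
  unfold silent; fun_prop

@[fun_prop]
theorem primrec_output (hf : Primrec f) (h₁ : Primrec g₁) (h₂ : Primrec g₂) (h₃ : Primrec g₃)
    (h₄ : Primrec g₄) : Primrec fun a => output (f a) (g₁ a) (g₂ a) (g₃ a) (g₄ a) := by
  unfold output; fun_prop

@[fun_prop]
theorem primrecPred_isReduced {r : α → RatCode} (hr : Primrec r) :
    PrimrecPred fun a => IsReduced (r a) := by
  unfold IsReduced; fun_prop

theorem primrec_rebuild : Primrec rebuild := by
  unfold rebuild; fun_prop

theorem primrecPred_valid : PrimrecPred Valid := by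
  have h := primrec_rebuild
  unfold Valid ValidGame ValidMachine
  fun_prop

theorem primrecPred_deterministic : PrimrecPred Deterministic := by
  unfold Deterministic
  fun_prop

end

theorem ofFn_eq_map_range {α : Type*} {n : ℕ} (f : ℕ → α) :
    List.ofFn (fun i : Fin n => f i) = (List.range n).map f :=
  List.ext_getElem (by simp) (by simp)

theorem getD_ofFn {α : Type*} {n : ℕ} (f : Fin n → α) (i : Fin n) (d : α) :
    (List.ofFn f).getD i d = f i := by
  simp [List.getD_eq_getElem?_getD]

theorem isReduced_encodeRat (q : ℚ) : IsReduced (encodeRat q) := by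
  refine ⟨q.den_pos, fun e _ h₁ h₂ => ?_⟩
  have h : (encodeRat q).1.toNat + (-(encodeRat q).1).toNat = q.num.natAbs := by
    simp only [encodeRat]
    lia
  rw [h] at h₁
  exact Nat.eq_one_of_dvd_coprimes q.reduced (Nat.dvd_of_mod_eq_zero h₁) (Nat.dvd_of_mod_eq_zero h₂)

/-- The rational number with a given code. -/
def ratOfCode (r : RatCode) : ℚ := (r.1 : ℚ) / (r.2 : ℚ)

theorem encodeRat_ratOfCode {r : RatCode} (h : IsReduced r) : encodeRat (ratOfCode r) = r := by
  obtain ⟨h₀, h⟩ := h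
  have hc : Nat.Coprime r.1.natAbs r.2 := by
    refine h _ (Nat.lt_succ_of_le (Nat.gcd_le_right _ h₀)) ?_ ?_
    · rw [show r.1.toNat + (-r.1).toNat = r.1.natAbs by lia]
      exact Nat.mod_eq_zero_of_dvd (Nat.gcd_dvd_left _ _)
    · exact Nat.mod_eq_zero_of_dvd (Nat.gcd_dvd_right _ _)
  have h₁ : ((r.2 : ℤ) : ℚ) = (r.2 : ℚ) := by simp
  refine Prod.ext ?_ ?_
  · have := Rat.num_div_eq_of_coprime (a := r.1) (b := r.2) (by exact_mod_cast h₀) (by simpa using hc)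
    rwa [h₁] at this
  · have := Rat.den_div_eq_of_coprime (a := r.1) (b := r.2) (by exact_mod_cast h₀) (by simpa using hc)
    rw [h₁] at this
    exact Int.ofNat.inj this

section Encode

variable {n m k : ℕ} (I : Instance n m k)

@[simp]
theorem numVertices_encode : numVertices I.encode = m := by
  simp [numVertices, Instance.encode, DSGame.encode]

@[simp]
theorem numPlayers_encode : numPlayers I.encode = n := by
  simp [numPlayers, Instance.encode, DSGame.encode]

@[simp]
theorem numStates_encode : numStates I.encode = k := by
  simp [numStates, Instance.encode, Mealy.encode]

@[simp]
theorem owner_encode (u : Fin m) : owner I.encode u = I.game.owner u :=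
  getD_ofFn _ u 0

@[simp]
theorem edge_encode (u v : Fin m) : edge I.encode u v = true ↔ I.game.Edge u v := by
  simp only [edge, Instance.encode, DSGame.encode, getD_ofFn, decide_eq_true_eq]

@[simp]
theorem reward_encode (i : Fin n) (u v : Fin m) :
    reward I.encode i u v = encodeRat (I.game.reward i u v) := by
  simp only [reward, Instance.encode, DSGame.encode, getD_ofFn]

@[simp]
theorem discount_encode : discount I.encode = encodeRat I.game.discount := rfl

@[simp]
theorem start_encode : start I.encode = I.start := rfl

@[simp]
theorem leader_encode : leader I.encode = I.leader := rfl

@[simp]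
theorem threshold_encode : threshold I.encode = encodeRat I.threshold := rfl

@[simp]
theorem silent_encode (p : Fin k) (u : Fin m) (q : Fin k) :
    silent I.encode p u q = true ↔ I.machine.silent p u q := by
  simp only [silent, Instance.encode, Mealy.encode, getD_ofFn, decide_eq_true_eq]

@[simp]
theorem output_encode (p : Fin k) (u : Fin m) (q : Fin k) (v : Fin m) :
    output I.encode p u q v = true ↔ I.machine.output p u q v := by
  simp only [output, Instance.encode, Mealy.encode, getD_ofFn, decide_eq_true_eq]

theorem owner_eq_leader_encode (u : Fin m) :
    owner I.encode u = leader I.encode ↔ I.game.owner u = I.leader := by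
  simp [Fin.ext_iff]

theorem rebuild_encode : rebuild I.encode = I.encode := by
  have h : ∀ {α : Type} {l : ℕ} (f : ℕ → α), (List.range l).map f = List.ofFn fun i : Fin l => f i :=
    fun f => (ofFn_eq_map_range f).symm
  have he : ∀ u v : Fin m, edge I.encode u v = @decide (I.game.Edge u v) (Classical.dec _) :=
    fun u v => by rw [Bool.eq_iff_iff]; simp
  have hs : ∀ (p : Fin k) (u : Fin m) (q : Fin k),
      silent I.encode p u q = @decide (I.machine.silent p u q) (Classical.dec _) :=
    fun p u q => by rw [Bool.eq_iff_iff]; simp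
  have ho : ∀ (p : Fin k) (u : Fin m) (q : Fin k) (v : Fin m),
      output I.encode p u q v = @decide (I.machine.output p u q v) (Classical.dec _) :=
    fun p u q v => by rw [Bool.eq_iff_iff]; simp
  simp only [rebuild, h, numVertices_encode, numPlayers_encode, numStates_encode, owner_encode, he,
    reward_encode, hs, ho]
  rfl

theorem valid_encode : Valid I.encode := by
  refine ⟨rebuild_encode I, ⟨?_, ?_, ?_, ?_⟩, ?_⟩
  · simp only [numVertices_encode, numPlayers_encode]
    intro u hu
    lift u to Fin m using hu
    simp
  · simp only [numVertices_encode]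
    intro u hu
    lift u to Fin m using hu
    obtain ⟨v, hv⟩ := I.game.exists_edge u
    exact ⟨v, v.2, (edge_encode I u v).2 hv⟩
  · simp only [numVertices_encode, numPlayers_encode]
    intro i hi u hu v hv
    lift i to Fin n using hi
    lift u to Fin m using hu
    lift v to Fin m using hv
    rw [reward_encode]
    exact isReduced_encodeRat _
  · have h₀ : 0 < I.game.discount.num := Rat.num_pos.2 I.game.discount_pos
    have h₁ : I.game.discount.num < I.game.discount.den := by
      have h := Rat.num_div_den I.game.discount
      have h₂ := I.game.discount_lt_one
      rw [← h, div_lt_one (by exact_mod_cast I.game.discount.den_pos)] at h₂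
      exact_mod_cast h₂
    simp only [discount_encode, start_encode, numVertices_encode, leader_encode, numPlayers_encode,
      threshold_encode, isReduced_encodeRat, Fin.is_lt, true_and, and_true]
    simp only [encodeRat]
    lia
  · simp only [ValidMachine, numVertices_encode, numStates_encode]
    refine ⟨I.machine.init.2, ?_, ?_, ?_, ?_⟩
    · intro p hp u hu q hq
      lift p to Fin k using hp
      lift u to Fin m using hu
      lift q to Fin k using hq
      rw [silent_encode, Ne, owner_eq_leader_encode]
      exact I.machine.silent_owner p u q
    · intro p hp u hu q hq v hv
      lift p to Fin k using hp
      lift u to Fin m using hu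
      lift q to Fin k using hq
      lift v to Fin m using hv
      rw [output_encode, owner_eq_leader_encode]
      exact I.machine.output_owner p u q v
    · intro p hp u hu q hq v hv
      lift p to Fin k using hp
      lift u to Fin m using hu
      lift q to Fin k using hq
      lift v to Fin m using hv
      rw [output_encode, edge_encode]
      exact I.machine.output_edge p u q v
    · intro p hp u hu
      lift p to Fin k using hp
      lift u to Fin m using hu
      refine (I.machine.exists_transition p u).imp ?_ ?_
      · rintro ⟨q, hq⟩
        exact ⟨q, q.2, (silent_encode I p u q).2 hq⟩
      · rintro ⟨q, v, hq⟩
        exact ⟨q, q.2, v, v.2, (output_encode I p u q v).2 hq⟩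

theorem deterministic_encode : Deterministic I.encode ↔ I.machine.Deterministic := by
  simp only [Deterministic, Mealy.Deterministic, numVertices_encode, numStates_encode]
  constructor
  · intro H p u
    obtain ⟨h₁, h₂⟩ := H p p.2 u u.2
    rw [Ne, owner_eq_leader_encode] at h₁
    rw [owner_eq_leader_encode] at h₂
    refine ⟨fun h => ?_, fun h => ?_⟩
    · obtain ⟨q, hq, hs, hu⟩ := h₁ h
      lift q to Fin k using hq
      exact ⟨q, (silent_encode ..).1 hs, fun q' h' =>
        Fin.ext (hu q' q'.2 ((silent_encode ..).2 h'))⟩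
    · obtain ⟨q, hq, v, hv, hs, hu⟩ := h₂ h
      lift q to Fin k using hq
      lift v to Fin m using hv
      refine ⟨(q, v), (output_encode ..).1 hs, fun qv h' => ?_⟩
      obtain ⟨h₃, h₄⟩ := hu qv.1 qv.1.2 qv.2 qv.2.2 ((output_encode ..).2 h')
      exact Prod.ext (Fin.ext h₃) (Fin.ext h₄)
  · intro H p hp u hu
    lift p to Fin k using hp
    lift u to Fin m using hu
    obtain ⟨h₁, h₂⟩ := H p u
    rw [Ne, owner_eq_leader_encode]
    refine ⟨fun h => ?_, fun h => ?_⟩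
    · obtain ⟨q, hq, hu⟩ := h₁ h
      refine ⟨q, q.2, (silent_encode ..).2 hq, fun q' hq' h' => ?_⟩
      lift q' to Fin k using hq'
      rw [hu q' ((silent_encode ..).1 h')]
    · obtain ⟨⟨q, v⟩, hq, hu⟩ := h₂ h
      refine ⟨q, q.2, v, v.2, (output_encode ..).2 hq, fun q' hq' v' hv' h' => ?_⟩
      lift q' to Fin k using hq'
      lift v' to Fin m using hv'
      have := hu (q', v') ((output_encode ..).1 h')
      simp only [Prod.mk.injEq] at this
      exact ⟨congrArg _ this.1, congrArg _ this.2⟩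

end Encode

/-- The game with a given code. -/
def toDSGame {c : InstanceCode} (h : ValidGame c) :
    DSGame (Fin (numPlayers c)) (Fin (numVertices c)) where
  owner u := ⟨owner c u, h.1 u u.2⟩
  Edge u v := edge c u v = true
  exists_edge u := by
    obtain ⟨v, hv, huv⟩ := h.2.1 u u.2
    exact ⟨⟨v, hv⟩, huv⟩
  reward i u v := ratOfCode (reward c i u v)
  discount := ratOfCode (discount c)
  discount_pos := by
    obtain ⟨_, _, _, h₀, h₁, _⟩ := h
    have h₂ : 0 < (discount c).1 := by lia
    have h₃ := h₀.1
    rw [ratOfCode]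
    positivity
  discount_lt_one := by
    obtain ⟨_, _, _, h₀, _, h₁, _⟩ := h
    have h₃ := h₀.1
    rw [ratOfCode, div_lt_one (by positivity)]
    have h₂ : (discount c).1 < (discount c).2 := by lia
    exact_mod_cast h₂

/-- The instance with a given code. -/
noncomputable def toInstance {c : InstanceCode} (h : ValidGame c) (h' : ValidMachine c) :
    Instance (numPlayers c) (numVertices c) (numStates c) where
  game := toDSGame h
  start := ⟨start c, by obtain ⟨_, _, _, _, _, _, h, _⟩ := h; exact h⟩
  leader := ⟨leader c, by obtain ⟨_, _, _, _, _, _, _, h, _⟩ := h; exact h⟩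
  threshold := ratOfCode (threshold c)
  machine :=
    { init := ⟨init c, h'.1⟩
      silent := fun p u q => silent c p u q = true
      output := fun p u q v => output c p u q v = true
      silent_owner := fun p u q hq hu =>
        h'.2.1 p p.2 u u.2 q q.2 hq (congrArg Fin.val hu)
      output_owner := fun p u q v hq =>
        Fin.ext (h'.2.2.1 p p.2 u u.2 q q.2 v v.2 hq)
      output_edge := fun p u q v hq => h'.2.2.2.1 p p.2 u u.2 q q.2 v v.2 hq
      exists_transition := fun p u => by
        refine (h'.2.2.2.2 p p.2 u u.2).imp ?_ ?_
        · rintro ⟨q, hq, h⟩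
          exact ⟨⟨q, hq⟩, h⟩
        · rintro ⟨q, hq, v, hv, h⟩
          exact ⟨⟨q, hq⟩, ⟨v, hv⟩, h⟩ }

theorem encode_toInstance {c : InstanceCode} (h : Valid c) :
    (toInstance h.2.1 h.2.2).encode = c := by
  obtain ⟨h, hg, hm⟩ := h
  have he : ∀ u v, @decide ((toInstance hg hm).game.Edge u v) (Classical.propDecidable _) =
      edge c u v := fun u v => Bool.eq_iff_iff.2 (@decide_eq_true_iff _ (_))
  have hs : ∀ p u q, @decide ((toInstance hg hm).machine.silent p u q) (Classical.propDecidable _) =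
      silent c p u q := fun p u q => Bool.eq_iff_iff.2 (@decide_eq_true_iff _ (_))
  have ho : ∀ p u q v,
      @decide ((toInstance hg hm).machine.output p u q v) (Classical.propDecidable _) =
        output c p u q v := fun p u q v => Bool.eq_iff_iff.2 (@decide_eq_true_iff _ (_))
  have hr : ∀ i u v, encodeRat ((toInstance hg hm).game.reward i u v) = reward c i u v :=
    fun i u v => encodeRat_ratOfCode (hg.2.2.1 i i.2 u u.2 v v.2)
  have hd : encodeRat (toInstance hg hm).game.discount = discount c :=
    encodeRat_ratOfCode (by obtain ⟨_, _, _, h, _⟩ := hg; exact h)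
  have ht : encodeRat (toInstance hg hm).threshold = threshold c :=
    encodeRat_ratOfCode (by obtain ⟨_, _, _, _, _, _, _, _, h⟩ := hg; exact h)
  conv_rhs => rw [← h]
  simp only [Instance.encode, DSGame.encode, Mealy.encode, he, hs, ho, hr, hd, ht,
    rebuild, ← ofFn_eq_map_range]
  rfl

end Code

/-! ### Forbidden assignments -/

namespace Code

/-- Finite partial assignments: `((false, w), y)` assigns the successor `y` to the history `w`, and
`((true, w), q)` assigns the state `q` to the possibly empty history `w`. -/
abbrev Assignment := List ((Bool × List ℕ) × ℕ)

/-- The total assignment `x` extends `T`. -/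
def Agrees (x : Bool × List ℕ → ℕ) (T : Assignment) : Prop := ∀ e ∈ T, x e.1 = e.2

/-- The last vertex of a history. -/
def last (w : List ℕ) : ℕ := w.getD (w.length - 1) 0

/-- `w` is the list of the vertices of a history from the initial vertex. -/
def IsHistory (c : InstanceCode) (w : List ℕ) : Prop :=
  0 < w.length ∧ w.getD 0 0 = start c ∧ (∀ j < w.length, w.getD j 0 < numVertices c) ∧
    ∀ j < w.length - 1, edge c (w.getD j 0) (w.getD (j + 1) 0) = true

/-- Along `w`, all moves of Leader and, from position `l` on, all moves of the other players except
for player `i` are those recorded in `T`.  No player is excepted if `i` is not a player. -/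
def MovesRecorded (c : InstanceCode) (T : Assignment) (w : List ℕ) (l i : ℕ) : Prop :=
  ∀ j < w.length - 1, (owner c (w.getD j 0) = leader c ∨ l ≤ j ∧ owner c (w.getD j 0) ≠ i) →
    ((false, w.take (j + 1)), w.getD (j + 1) 0) ∈ T

/-- The discount factor as a fraction. -/
def discountFrac (c : InstanceCode) : Frac := Frac.ofRatCode (discount c)

/-- All rewards are bounded by `K (1 - λ)`. -/
def IsRewardBound (c : InstanceCode) (K : ℕ) : Prop :=
  ∀ i < numPlayers c, ∀ u < numVertices c, ∀ v < numVertices c,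
    ((Frac.ofRatCode (reward c i u v)).add ((Frac.ofNat K).mul (discountFrac c))).Le
      (Frac.ofNat K) ∧
    ((Frac.ofNat K).mul (discountFrac c)).Le
      ((Frac.ofRatCode (reward c i u v)).add (Frac.ofNat K))

/-- The payoff of player `i` that is collected along the finite path `w`. -/
def partialPayoff (c : InstanceCode) (i : ℕ) (w : List ℕ) : Frac :=
  Frac.discountedSum (discountFrac c)
    (fun j => Frac.ofRatCode (reward c i (w.getD j 0) (w.getD (j + 1) 0))) (w.length - 1)

/-- If `K` is a reward bound, a bound for the payoff that is collected after the path `w`. -/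
def tailBound (c : InstanceCode) (K : ℕ) (w : List ℕ) : Frac :=
  (Frac.ofNat K).mul ((discountFrac c).pow (w.length - 1))

/-- `T` prescribes a move that is not possible. -/
def BadMove (c : InstanceCode) (T : Assignment) : Prop :=
  ∃ (w : List ℕ) (y : ℕ), IsHistory c w ∧ ((false, w), y) ∈ T ∧
    ¬ (y < numVertices c ∧ edge c (last w) y = true)

/-- `T` violates the transition relation of the machine. -/
def BadTransition (c : InstanceCode) (T : Assignment) : Prop :=
  ∃ (w : List ℕ) (p q y : ℕ), IsHistory c w ∧ ((true, w.take (w.length - 1)), p) ∈ T ∧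
    ((true, w), q) ∈ T ∧ ((false, w), y) ∈ T ∧
    ¬ (p < numStates c ∧ q < numStates c ∧
      (owner c (last w) ≠ leader c → silent c p (last w) q = true) ∧
      (owner c (last w) = leader c → output c p (last w) q y = true))

/-- `T` does not label the empty history by the initial state. -/
def BadInit (c : InstanceCode) (T : Assignment) : Prop :=
  ∃ p : ℕ, ((true, []), p) ∈ T ∧ p ≠ init c

/-- The moves in `T` guarantee that the payoff of Leader exceeds the threshold. -/
def HighPayoff (c : InstanceCode) (T : Assignment) : Prop :=
  ∃ (w : List ℕ) (K : ℕ), IsHistory c w ∧ MovesRecorded c T w 0 (numPlayers c) ∧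
    IsRewardBound c K ∧
    ((Frac.ofRatCode (threshold c)).add (tailBound c K w)).Lt (partialPayoff c (leader c) w)

/-- The moves in `T` guarantee that a player other than Leader has a profitable deviation. -/
def ProfitableDeviation (r : Rationality) (c : InstanceCode) (T : Assignment) : Prop :=
  ∃ (w w' : List ℕ) (l i K : ℕ), (r = .nash → l = 0) ∧ i < numPlayers c ∧ i ≠ leader c ∧
    IsHistory c w ∧ IsHistory c w' ∧ w.length = w'.length ∧ l < w.length ∧
    w.take (l + 1) = w'.take (l + 1) ∧
    MovesRecorded c T w l i ∧ MovesRecorded c T w' l (numPlayers c) ∧ IsRewardBound c K ∧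
    ((partialPayoff c i w').add ((Frac.ofNat 2).mul (tailBound c K w))).Lt (partialPayoff c i w)

/-- `T` guarantees that an assignment does not describe a counterexample: an equilibrium in which
Leader complies with the machine and does not get more than the threshold. -/
def Forbidden (r : Rationality) (c : InstanceCode) (T : Assignment) : Prop :=
  BadMove c T ∨ BadTransition c T ∨ BadInit c T ∨ HighPayoff c T ∨ ProfitableDeviation r c T

section

variable {α : Type*} [Primcodable α] {f : α → InstanceCode} {t : α → Assignment}
  {w : α → List ℕ} {g₁ g₂ : α → ℕ}

@[fun_prop]
theorem primrec_last (hw : Primrec w) : Primrec fun a => last (w a) := by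
  unfold last; fun_prop

@[fun_prop]
theorem primrecPred_isHistory (hf : Primrec f) (hw : Primrec w) :
    PrimrecPred fun a => IsHistory (f a) (w a) := by
  unfold IsHistory; fun_prop

@[fun_prop]
theorem primrecPred_movesRecorded (hf : Primrec f) (ht : Primrec t) (hw : Primrec w)
    (h₁ : Primrec g₁) (h₂ : Primrec g₂) :
    PrimrecPred fun a => MovesRecorded (f a) (t a) (w a) (g₁ a) (g₂ a) := by
  unfold MovesRecorded; fun_prop

@[fun_prop]
theorem primrec_discountFrac (hf : Primrec f) : Primrec fun a => discountFrac (f a) := by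
  unfold discountFrac; fun_prop

@[fun_prop]
theorem primrecPred_isRewardBound (hf : Primrec f) (h₁ : Primrec g₁) :
    PrimrecPred fun a => IsRewardBound (f a) (g₁ a) := by
  unfold IsRewardBound; fun_prop

@[fun_prop]
theorem primrec_partialPayoff (hf : Primrec f) (h₁ : Primrec g₁) (hw : Primrec w) :
    Primrec fun a => partialPayoff (f a) (g₁ a) (w a) := by
  unfold partialPayoff; fun_prop

@[fun_prop]
theorem primrec_tailBound (hf : Primrec f) (h₁ : Primrec g₁) (hw : Primrec w) :
    Primrec fun a => tailBound (f a) (g₁ a) (w a) := by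
  unfold tailBound; fun_prop

theorem sigmaOne_forbidden (r : Rationality) :
    SigmaOne fun a : InstanceCode × Assignment => Forbidden r a.1 a.2 := by
  unfold Forbidden BadMove BadTransition BadInit HighPayoff ProfitableDeviation
  refine .or ?_ (.or ?_ (.or ?_ (.or ?_ ?_)))
  · refine .exists <| .exists <| .of_primrecPred ?_
    fun_prop
  · refine .exists <| .exists <| .exists <| .exists <| .of_primrecPred ?_
    fun_prop
  · refine .exists <| .of_primrecPred ?_
    fun_prop
  · refine .exists <| .exists <| .of_primrecPred ?_
    fun_prop
  · refine .exists <| .exists <| .exists <| .exists <| .exists <| .of_primrecPred ?_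
    fun_prop

end

end Code

/-! ### Assignments and strategy profiles -/

namespace Instance

open Code Game

variable {n m k : ℕ} {I : Instance n m k} {σ : Fin n → List (Fin m) → Fin m → Fin m}
  {x : Bool × List ℕ → ℕ} {ρ ρ' : ℕ → Fin m} {h : List (Fin m)} {v : Fin m}

/-- The code of the first `N` vertices of `ρ`. -/
def path (ρ : ℕ → Fin m) (N : ℕ) : List ℕ := (initialSegment ρ N).map Fin.val

@[simp]
theorem length_path (ρ : ℕ → Fin m) (N : ℕ) : (path ρ N).length = N := by simp [path]

theorem getD_path (ρ : ℕ → Fin m) {N j : ℕ} (hj : j < N) : (path ρ N).getD j 0 = ρ j := by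
  simp [path, List.getD_eq_getElem?_getD, initialSegment, hj]

theorem take_path (ρ : ℕ → Fin m) {N j : ℕ} (hj : j ≤ N) : (path ρ N).take j = path ρ j := by
  rw [path, ← List.map_take, take_initialSegment ρ hj, path]

theorem last_path (ρ : ℕ → Fin m) (N : ℕ) : last (path ρ (N + 1)) = ρ N := by
  rw [last, length_path, Nat.add_sub_cancel, getD_path ρ (Nat.lt_succ_self N)]

theorem path_succ (ρ : ℕ → Fin m) (N : ℕ) :
    path ρ (N + 1) = (initialSegment ρ N ++ [ρ N]).map Fin.val := by
  rw [path, initialSegment_succ]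

theorem isHistory_path (hρ : I.game.toGame.IsPlay I.start ρ) (N : ℕ) :
    IsHistory I.encode (path ρ (N + 1)) := by
  refine ⟨by simp, ?_, fun j hj => ?_, fun j hj => ?_⟩
  · rw [getD_path ρ (Nat.succ_pos N), hρ.1]
    rfl
  · rw [length_path] at hj
    rw [getD_path ρ hj, numVertices_encode]
    exact (ρ j).2
  · rw [length_path, Nat.add_sub_cancel] at hj
    rw [getD_path ρ (by lia), getD_path ρ (by lia), edge_encode]
    exact hρ.2 j

/-- Histories are initial segments of plays. -/
theorem exists_play_of_isHist (hh : I.game.toGame.IsHist I.start h v) :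
    ∃ ρ, I.game.toGame.IsPlay I.start ρ ∧ h = initialSegment ρ h.length ∧ v = ρ h.length := by
  choose f hf using I.game.exists_edge
  have hp : I.game.toGame.IsProfile I.start fun _ _ u => f u := fun _ _ u _ _ => hf u
  exact ⟨_, hp.isPlay_continuation hh, (initialSegment_continuation _ _ _ _).symm,
    (continuation_length _ _ _ _).symm⟩

theorem exists_isHist_of_isHistory {w : List ℕ} (hw : IsHistory I.encode w) :
    ∃ h v, I.game.toGame.IsHist I.start h v ∧ w = (h ++ [v]).map Fin.val := by
  obtain ⟨h₀, h₁, h₂, h₃⟩ := hw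
  rw [numVertices_encode] at h₂
  have h₂' : ∀ a ∈ w, a < m := fun a ha => by
    obtain ⟨j, hj, rfl⟩ := List.getElem_of_mem ha
    simpa [List.getD_eq_getElem?_getD, hj] using h₂ j hj
  lift w to List (Fin m) using h₂'
  rcases List.eq_nil_or_concat' w with rfl | ⟨h, v, rfl⟩
  · simp at h₀
  refine ⟨h, v, ⟨?_, ?_⟩, rfl⟩
  · rw [List.isChain_iff_getElem]
    intro j hj
    have := h₃ j (by rw [List.length_map]; lia)
    rw [List.getD_eq_getElem _ _ (by simp at hj ⊢; lia),
      List.getD_eq_getElem _ _ (by simp at hj ⊢; lia), List.getElem_map, List.getElem_map,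
      edge_encode] at this
    exact this
  · rw [List.getD_eq_getElem _ _ (by simp), List.getElem_map, start_encode] at h₁
    rw [List.head?_eq_getElem?, List.getElem?_eq_getElem (by simp)]
    exact congrArg _ (Fin.ext h₁)

/-- Every history is an initial segment of a play that obeys a given profile from its end on. -/
theorem exists_play_of_isHistory (hσ : I.game.toGame.IsProfile I.start σ) {w : List ℕ}
    (hw : IsHistory I.encode w) :
    ∃ ρ N, I.game.toGame.IsPlay I.start ρ ∧ w = path ρ (N + 1) ∧
      ∀ j, N ≤ j → I.game.toGame.Obeys σ ρ j := by
  obtain ⟨h, v, hh, rfl⟩ := exists_isHist_of_isHistory hw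
  refine ⟨_, h.length, hσ.isPlay_continuation hh, ?_, fun j hj => obeys_continuation _ _ _ _ hj⟩
  rw [path_succ, initialSegment_continuation, continuation_length]

/-- The moves assigned by `x` are those of the profile `σ`. -/
def Describes (I : Instance n m k) (x : Bool × List ℕ → ℕ)
    (σ : Fin n → List (Fin m) → Fin m → Fin m) : Prop :=
  ∀ h v, I.game.toGame.IsHist I.start h v →
    x (false, (h ++ [v]).map Fin.val) = σ (I.game.owner v) h v

theorem Describes.obeys_iff (hx : I.Describes x σ) (hρ : I.game.toGame.IsPlay I.start ρ) (j : ℕ) :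
    I.game.toGame.Obeys σ ρ j ↔ x (false, path ρ (j + 1)) = ρ (j + 1) := by
  rw [path_succ, hx _ _ (hρ.isHist j), Obeys, eq_comm, Fin.ext_iff]
  rfl

theorem Describes.obeys_of_movesRecorded (hx : I.Describes x σ)
    (hρ : I.game.toGame.IsPlay I.start ρ) {T : Assignment} (hT : Agrees x T) {N l i : ℕ}
    (h : MovesRecorded I.encode T (path ρ (N + 1)) l i) {j : ℕ} (hj : j < N)
    (hi : I.game.owner (ρ j) = I.leader ∨ l ≤ j ∧ (I.game.owner (ρ j) : ℕ) ≠ i) :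
    I.game.toGame.Obeys σ ρ j := by
  rw [hx.obeys_iff hρ]
  have := hT _ (h j (by simpa using hj) (by
    rw [getD_path ρ (by lia), owner_eq_leader_encode, owner_encode]
    exact hi))
  rwa [take_path ρ (by lia), getD_path ρ (by lia)] at this

/-- The moves of `x` along the path `w`. -/
def record (x : Bool × List ℕ → ℕ) (w : List ℕ) : Assignment :=
  (List.range w.length).map fun j => ((false, w.take (j + 1)), x (false, w.take (j + 1)))

theorem agrees_record (x : Bool × List ℕ → ℕ) (w : List ℕ) : Agrees x (record x w) := by
  intro e he
  obtain ⟨j, _, rfl⟩ := List.mem_map.1 he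
  rfl

theorem Describes.movesRecorded (hx : I.Describes x σ) (hρ : I.game.toGame.IsPlay I.start ρ)
    {T : Assignment} {N l i : ℕ} (hT : record x (path ρ (N + 1)) ⊆ T)
    (h : ∀ j < N, I.game.owner (ρ j) = I.leader ∨ l ≤ j ∧ (I.game.owner (ρ j) : ℕ) ≠ i →
      I.game.toGame.Obeys σ ρ j) :
    MovesRecorded I.encode T (path ρ (N + 1)) l i := by
  intro j hj hi
  rw [length_path, Nat.add_sub_cancel] at hj
  rw [getD_path ρ (by lia), owner_eq_leader_encode, owner_encode] at hi
  refine hT (List.mem_map.2 ⟨j, by simp; lia, ?_⟩)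
  rw [take_path ρ (by lia), getD_path ρ (by lia), (hx.obeys_iff hρ j).1 (h j hj hi)]

/-! ### Payoffs -/

theorem val_discountFrac (I : Instance n m k) :
    (discountFrac I.encode).val = (I.game.discount : ℝ) :=
  Frac.val_ofRatCode _

theorem den_discountFrac_pos (I : Instance n m k) : 0 < (discountFrac I.encode).2.2 :=
  Frac.den_ofRatCode_pos _

theorem discountFrac_snd (I : Instance n m k) : (discountFrac I.encode).2.1 = 0 := by
  have : 0 < I.game.discount.num := Rat.num_pos.2 I.game.discount_pos
  change (-I.game.discount.num).toNat = 0
  lia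

theorem discount_pos (I : Instance n m k) : (0 : ℝ) < I.game.discount := by
  exact_mod_cast I.game.discount_pos

theorem discount_lt_one (I : Instance n m k) : (I.game.discount : ℝ) < 1 := by
  exact_mod_cast I.game.discount_lt_one

theorem partialPayoff_spec (I : Instance n m k) (i : Fin n) (ρ : ℕ → Fin m) (N : ℕ) :
    0 < (partialPayoff I.encode i (path ρ (N + 1))).2.2 ∧
      (partialPayoff I.encode i (path ρ (N + 1))).val =
        ∑ j ∈ Finset.range N, (I.game.discount : ℝ) ^ j * (I.game.reward i (ρ j) (ρ (j + 1)) : ℝ) := by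
  have hr : ∀ j < N, reward I.encode i ((path ρ (N + 1)).getD j 0)
      ((path ρ (N + 1)).getD (j + 1) 0) = encodeRat (I.game.reward i (ρ j) (ρ (j + 1))) := by
    intro j hj
    rw [getD_path ρ (by lia), getD_path ρ (by lia), reward_encode]
  rw [partialPayoff, length_path, Nat.add_sub_cancel]
  obtain ⟨h₁, h₂⟩ := Frac.discountedSum_spec (den_discountFrac_pos I) (discountFrac_snd I) N
    (r := fun j => Frac.ofRatCode (reward I.encode i ((path ρ (N + 1)).getD j 0)
      ((path ρ (N + 1)).getD (j + 1) 0))) fun j hj => by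
        rw [hr j hj]
        exact Frac.den_ofRatCode_pos _
  refine ⟨h₁, h₂.trans (Finset.sum_congr rfl fun j hj => ?_)⟩
  rw [hr j (Finset.mem_range.1 hj), val_discountFrac, Frac.val_ofRatCode]

theorem tailBound_spec (I : Instance n m k) (K : ℕ) (ρ : ℕ → Fin m) (N : ℕ) :
    0 < (tailBound I.encode K (path ρ (N + 1))).2.2 ∧
      (tailBound I.encode K (path ρ (N + 1))).val = K * (I.game.discount : ℝ) ^ N := by
  rw [tailBound, length_path, Nat.add_sub_cancel]
  refine ⟨Frac.den_mul_pos one_pos (Frac.den_pow_pos (den_discountFrac_pos I) N), ?_⟩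
  rw [Frac.val_mul, Frac.val_pow (discountFrac_snd I), Frac.val_ofNat, val_discountFrac]

theorem isRewardBound_iff (I : Instance n m k) (K : ℕ) :
    IsRewardBound I.encode K ↔
      ∀ i u v, |(I.game.reward i u v : ℝ)| ≤ K * (1 - I.game.discount) := by
  have key : ∀ (i : Fin n) (u v : Fin m),
      (((Frac.ofRatCode (reward I.encode i u v)).add
          ((Frac.ofNat K).mul (discountFrac I.encode))).Le (Frac.ofNat K) ∧
        ((Frac.ofNat K).mul (discountFrac I.encode)).Le
          ((Frac.ofRatCode (reward I.encode i u v)).add (Frac.ofNat K))) ↔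
      |(I.game.reward i u v : ℝ)| ≤ K * (1 - I.game.discount) := by
    intro i u v
    have h₁ : 0 < (Frac.ofNat K).2.2 := one_pos
    have h₂ := Frac.den_mul_pos h₁ (den_discountFrac_pos I)
    have h₃ := Frac.den_ofRatCode_pos (I.game.reward i u v)
    rw [reward_encode, Frac.le_iff (Frac.den_add_pos h₃ h₂) h₁,
      Frac.le_iff h₂ (Frac.den_add_pos h₃ h₁), Frac.val_add h₃ h₂, Frac.val_add h₃ h₁,
      Frac.val_mul, Frac.val_ofNat, Frac.val_ofRatCode, val_discountFrac, abs_le]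
    constructor <;> rintro ⟨h₄, h₅⟩ <;> constructor <;> linarith
  simp only [IsRewardBound, numVertices_encode, numPlayers_encode]
  constructor
  · intro H i u v
    exact (key i u v).1 (H i i.2 u u.2 v v.2)
  · intro H i hi u hu v hv
    lift i to Fin n using hi
    lift u to Fin m using hu
    lift v to Fin m using hv
    exact (key i u v).2 (H i u v)

theorem exists_isRewardBound (I : Instance n m k) : ∃ K, IsRewardBound I.encode K := by
  obtain ⟨K, hK⟩ := Finite.exists_le fun a : Fin n × Fin m × Fin m =>
    ⌈|(I.game.reward a.1 a.2.1 a.2.2 : ℝ)| / (1 - I.game.discount)⌉₊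
  refine ⟨K, (isRewardBound_iff I K).2 fun i u v => ?_⟩
  have := (Nat.le_ceil _).trans (Nat.cast_le.2 (hK (i, u, v)))
  rwa [div_le_iff₀ (sub_pos.2 I.discount_lt_one)] at this

theorem abs_payoff_sub_le {K : ℕ} (hK : IsRewardBound I.encode K) (i : Fin n) (ρ : ℕ → Fin m)
    (N : ℕ) :
    |I.game.toGame.payoff ρ i - (partialPayoff I.encode i (path ρ (N + 1))).val| ≤
      (tailBound I.encode K (path ρ (N + 1))).val := by
  rw [(partialPayoff_spec I i ρ N).2, (tailBound_spec I K ρ N).2]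
  exact abs_tsum_sub_sum_le I.discount_pos I.discount_lt_one
    (fun j => (isRewardBound_iff I K).1 hK i _ _) N

open Filter Topology in
theorem tendsto_partialPayoff (I : Instance n m k) (K : ℕ) (C : ℝ) (i : Fin n) (ρ : ℕ → Fin m) :
    Tendsto (fun N => (partialPayoff I.encode i (path ρ (N + 1))).val +
      C * (tailBound I.encode K (path ρ (N + 1))).val) atTop (𝓝 (I.game.toGame.payoff ρ i)) := by
  obtain ⟨K', hK'⟩ := I.exists_isRewardBound
  have := tendsto_sum_discounted I.discount_pos I.discount_lt_one
    (fun j => (isRewardBound_iff I K').1 hK' i (ρ j) (ρ (j + 1))) (C * K)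
  refine this.congr fun N => ?_
  rw [(partialPayoff_spec I i ρ N).2, (tailBound_spec I K ρ N).2, mul_assoc]

/-- As the error bounds tend to zero, strict inequalities between payoffs are seen after finitely
many steps. -/
theorem Describes.exists_highPayoff_iff (hx : I.Describes x σ)
    (hσ : I.game.toGame.IsProfile I.start σ) :
    (∃ T, HighPayoff I.encode T ∧ Agrees x T) ↔
      (I.threshold : ℝ) < I.game.toGame.payoff (I.game.toGame.outcome I.start σ) I.leader := by
  constructor
  · rintro ⟨T, ⟨w, K, hw, hm, hK, hlt⟩, hT⟩
    obtain ⟨ρ, N, hρ, rfl, hob⟩ := exists_play_of_isHistory hσ hw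
    have hρ' : ρ = I.game.toGame.outcome I.start σ := by
      refine eq_of_obeys (l := 0) (fun j hj => ?_) (fun j _ => ?_) fun j _ => obeys_outcome _ _ _ j
      · obtain rfl : j = 0 := by lia
        exact hρ.1
      · rcases lt_or_ge j N with hj | hj
        · refine hx.obeys_of_movesRecorded hρ hT hm hj (.inr ⟨j.zero_le, ?_⟩)
          rw [numPlayers_encode]
          exact (Fin.is_lt _).ne
        · exact hob j hj
    have h₁ := Frac.den_ofRatCode_pos I.threshold
    have h₂ := (tailBound_spec I K ρ N).1
    rw [threshold_encode, leader_encode, Frac.lt_iff (Frac.den_add_pos h₁ h₂)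
      (partialPayoff_spec I _ ρ N).1, Frac.val_add h₁ h₂, Frac.val_ofRatCode] at hlt
    have := (abs_le.1 (abs_payoff_sub_le hK I.leader ρ N)).1
    rw [← hρ']
    linarith
  · intro hlt
    obtain ⟨K, hK⟩ := I.exists_isRewardBound
    have hρ := hσ.isPlay_outcome
    obtain ⟨N, hN⟩ := ((I.tendsto_partialPayoff K (-1) I.leader _).eventually_const_lt hlt).exists
    refine ⟨_, ⟨_, K, isHistory_path hρ N, hx.movesRecorded hρ (List.Subset.refl _) fun j _ _ =>
      obeys_outcome _ _ _ j, hK, ?_⟩, agrees_record x _⟩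
    have h₁ := Frac.den_ofRatCode_pos I.threshold
    have h₂ := (tailBound_spec I K (I.game.toGame.outcome I.start σ) N).1
    rw [threshold_encode, leader_encode, Frac.lt_iff (Frac.den_add_pos h₁ h₂)
      (partialPayoff_spec I _ _ N).1, Frac.val_add h₁ h₂, Frac.val_ofRatCode]
    linarith

theorem Describes.exists_profitableDeviation_iff (hx : I.Describes x σ)
    (hσ : I.game.toGame.IsProfile I.start σ) (r : Rationality) :
    (∃ T, ProfitableDeviation r I.encode T ∧ Agrees x T) ↔
      ¬ I.game.toGame.IsFixedEquilibrium r I.start I.leader σ := by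
  have hn : ∀ u : Fin m, (I.game.owner u : ℕ) ≠ numPlayers I.encode := fun u => by
    rw [numPlayers_encode]
    exact (Fin.is_lt _).ne
  rw [isFixedEquilibrium_iff hσ]
  push Not
  constructor
  · rintro ⟨T, ⟨w, w', l, i, K, hr, hi, hiL, hw, hw', hlen, hl, htake, hm, hm', hK, hlt⟩, hT⟩
    rw [numPlayers_encode] at hi
    lift i to Fin n using hi
    obtain ⟨ρ, N, hρ, rfl, hob⟩ := exists_play_of_isHistory hσ hw
    obtain ⟨ρ', N', hρ', rfl, hob'⟩ := exists_play_of_isHistory hσ hw'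
    obtain rfl : N = N' := by simpa using hlen
    rw [length_path] at hl
    rw [take_path _ hl, take_path _ hl] at htake
    refine ⟨l, i, ρ, ρ', hr, ⟨?_, hρ, hρ', fun j hj => ?_, fun j hj => ?_, fun j hj => ?_⟩, ?_⟩
    · rw [leader_encode] at hiL
      exact fun h => hiL (congrArg _ h)
    · refine eq_of_initialSegment_eq ?_ (Nat.lt_succ_of_le hj)
      exact List.map_injective_iff.2 Fin.val_injective htake
    · rcases lt_or_ge j N with hjN | hjN
      · refine hx.obeys_of_movesRecorded hρ hT hm hjN (hj.imp_right fun h => ⟨h.1, ?_⟩)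
        exact fun h' => h.2 (Fin.ext h')
      · exact hob j hjN
    · rcases lt_or_ge j N with hjN | hjN
      · exact hx.obeys_of_movesRecorded hρ' hT hm' hjN (hj.imp_right fun h => ⟨h, hn _⟩)
      · exact hob' j hjN
    · have h₁ := (partialPayoff_spec I i ρ' N).1
      have h₂ := Frac.den_mul_pos (a := Frac.ofNat 2) one_pos (tailBound_spec I K ρ N).1
      rw [Frac.lt_iff (Frac.den_add_pos h₁ h₂) (partialPayoff_spec I i ρ N).1, Frac.val_add h₁ h₂,
        Frac.val_mul, Frac.val_ofNat] at hlt
      have h₃ := (abs_le.1 (abs_payoff_sub_le hK i ρ N)).1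
      have h₄ := (abs_le.1 (abs_payoff_sub_le hK i ρ' N)).2
      rw [(tailBound_spec I K _ N).2] at h₃ h₄ hlt
      push_cast at hlt
      linarith
  · rintro ⟨l, i, ρ, ρ', hr, D, hlt⟩
    obtain ⟨K, hK⟩ := I.exists_isRewardBound
    -- the sums along `ρ`, diminished by twice the tail bound, still tend to the payoff of `ρ`
    obtain ⟨N, hN, hl⟩ := (((I.tendsto_partialPayoff K 0 i ρ').eventually_lt
      (I.tendsto_partialPayoff K (-2) i ρ) hlt).and (Filter.eventually_ge_atTop l)).exists
    refine ⟨record x (path ρ (N + 1)) ++ record x (path ρ' (N + 1)),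
      ⟨path ρ (N + 1), path ρ' (N + 1), l, i, K, hr, ?_, ?_, isHistory_path D.isPlay N,
        isHistory_path D.isPlay' N, by simp, by simp; lia, ?_,
        hx.movesRecorded D.isPlay (List.subset_append_left _ _) fun j _ hj => ?_,
        hx.movesRecorded D.isPlay' (List.subset_append_right _ _) fun j _ hj => ?_, hK, ?_⟩,
      fun e he => ?_⟩
    · rw [numPlayers_encode]
      exact i.2
    · rw [leader_encode]
      exact fun h => D.ne (Fin.ext h)
    · rw [take_path _ (by lia), take_path _ (by lia), path, path,
        initialSegment_congr fun j hj => D.agree j (by lia)]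
    · exact D.obeys j (hj.imp_right fun h => ⟨h.1, fun h' => h.2 (congrArg _ h')⟩)
    · exact D.obeys' j (hj.imp_right fun h => h.1)
    · have h₁ := (partialPayoff_spec I i ρ' N).1
      have h₂ := Frac.den_mul_pos (a := Frac.ofNat 2) one_pos (tailBound_spec I K ρ N).1
      rw [Frac.lt_iff (Frac.den_add_pos h₁ h₂) (partialPayoff_spec I i ρ N).1, Frac.val_add h₁ h₂,
        Frac.val_mul, Frac.val_ofNat]
      push_cast
      linarith
    · rcases List.mem_append.1 he with he | he
      · exact agrees_record x _ e he
      · exact agrees_record x _ e he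

/-! ### Moves and states -/

theorem exists_badMove_iff (I : Instance n m k) (x : Bool × List ℕ → ℕ) :
    (∃ T, BadMove I.encode T ∧ Agrees x T) ↔
      ¬ ∀ h v, I.game.toGame.IsHist I.start h v →
        ∃ y : Fin m, x (false, (h ++ [v]).map Fin.val) = y ∧ I.game.Edge v y := by
  push Not
  constructor
  · rintro ⟨T, ⟨w, y, hw, hy, hbad⟩, hT⟩
    obtain ⟨h, v, hh, rfl⟩ := exists_isHist_of_isHistory hw
    refine ⟨h, v, hh, fun y' hy' hE => hbad ?_⟩
    have h₁ : x (false, (h ++ [v]).map Fin.val) = y := hT _ hy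
    rw [hy'] at h₁
    subst h₁
    have hlast : last ((h ++ [v]).map Fin.val) = v := by simp [last]
    rw [hlast, numVertices_encode, edge_encode]
    exact ⟨y'.2, hE⟩
  · rintro ⟨h, v, hh, H⟩
    obtain ⟨ρ, hρ, hh', hv⟩ := exists_play_of_isHist hh
    rw [hh', hv, ← path_succ] at H
    refine ⟨[((false, path ρ (h.length + 1)), x (false, path ρ (h.length + 1)))],
      ⟨_, _, isHistory_path hρ _, List.mem_singleton_self _, ?_⟩, by simp [Agrees]⟩
    rintro ⟨h₁, h₂⟩
    rw [numVertices_encode] at h₁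
    refine H ⟨_, h₁⟩ rfl ?_
    rw [last_path] at h₂
    exact (edge_encode I _ ⟨_, h₁⟩).1 h₂

theorem exists_badInit_iff (I : Instance n m k) (x : Bool × List ℕ → ℕ) :
    (∃ T, BadInit I.encode T ∧ Agrees x T) ↔ x (true, []) ≠ I.machine.init := by
  constructor
  · rintro ⟨T, ⟨p, hp, hne⟩, hT⟩
    have h : x (true, []) = p := hT _ hp
    rwa [h]
  · intro h
    exact ⟨[((true, []), x (true, []))], ⟨_, List.mem_singleton_self _, h⟩, by simp [Agrees]⟩

theorem exists_badTransition_iff (I : Instance n m k) (x : Bool × List ℕ → ℕ) :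
    (∃ T, BadTransition I.encode T ∧ Agrees x T) ↔
      ¬ ∀ h v, I.game.toGame.IsHist I.start h v →
        ∃ p q : Fin k, x (true, h.map Fin.val) = p ∧ x (true, (h ++ [v]).map Fin.val) = q ∧
          (I.game.owner v ≠ I.leader → I.machine.silent p v q) ∧
          (I.game.owner v = I.leader →
            output I.encode p v q (x (false, (h ++ [v]).map Fin.val)) = true) := by
  push Not
  constructor
  · rintro ⟨T, ⟨w, p, q, y, hw, hp, hq, hy, hbad⟩, hT⟩
    obtain ⟨h, v, hh, rfl⟩ := exists_isHist_of_isHistory hw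
    refine ⟨h, v, hh, fun p' q' hp' hq' h₁ => ?_⟩
    by_contra! h₂
    have hlen : ((h ++ [v]).map Fin.val).take (((h ++ [v]).map Fin.val).length - 1) =
      h.map Fin.val := by simp
    have hlast : last ((h ++ [v]).map Fin.val) = v := by simp [last]
    rw [hlen] at hp
    have h₃ := hT _ hp
    have h₄ := hT _ hq
    have h₅ := hT _ hy
    simp only at h₃ h₄ h₅
    rw [hp'] at h₃
    rw [hq'] at h₄
    subst h₃ h₄ h₅
    refine hbad ?_
    rw [hlast, numStates_encode, Ne, owner_eq_leader_encode, silent_encode]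
    exact ⟨p'.2, q'.2, h₁, h₂⟩
  · rintro ⟨h, v, hh, H⟩
    obtain ⟨ρ, hρ, hh', hv⟩ := exists_play_of_isHist hh
    rw [hh', hv, ← path_succ] at H
    refine ⟨[((true, path ρ h.length), x (true, path ρ h.length)),
      ((true, path ρ (h.length + 1)), x (true, path ρ (h.length + 1))),
      ((false, path ρ (h.length + 1)), x (false, path ρ (h.length + 1)))],
      ⟨path ρ (h.length + 1), x (true, path ρ h.length), x (true, path ρ (h.length + 1)),
        x (false, path ρ (h.length + 1)), isHistory_path hρ _, ?_, ?_, ?_, ?_⟩, by simp [Agrees]⟩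
    · rw [length_path, Nat.add_sub_cancel, take_path _ (Nat.le_succ _)]
      simp
    · simp
    · simp
    · rintro ⟨h₁, h₂, h₃, h₄⟩
      rw [numStates_encode] at h₁ h₂
      rw [last_path, Ne, owner_eq_leader_encode] at h₃
      rw [last_path, owner_eq_leader_encode] at h₄
      obtain ⟨h₅, h₆⟩ := H ⟨_, h₁⟩ ⟨_, h₂⟩ rfl rfl fun h =>
        (silent_encode I ⟨_, h₁⟩ _ ⟨_, h₂⟩).1 (h₃ h)
      exact h₆ (h₄ h₅)

/-- An instance is positive exactly if every total assignment extends a forbidden one.  Values are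
bounded in order to obtain a compact space of total assignments; vertices and states are the only
values that matter, and they obey the bound. -/
theorem positive_iff (I : Instance n m k) (r : Rationality) :
    I.Positive r ↔
      ∀ x : Bool × List ℕ → ℕ, (∀ i, x i ≤ numVertices I.encode + numStates I.encode) →
        ∃ T, Forbidden r I.encode T ∧ Agrees x T := by
  have hF : ∀ x : Bool × List ℕ → ℕ, (∃ T, Forbidden r I.encode T ∧ Agrees x T) ↔
      (∃ T, BadMove I.encode T ∧ Agrees x T) ∨ (∃ T, BadTransition I.encode T ∧ Agrees x T) ∨
      (∃ T, BadInit I.encode T ∧ Agrees x T) ∨ (∃ T, HighPayoff I.encode T ∧ Agrees x T) ∨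
      ∃ T, ProfitableDeviation r I.encode T ∧ Agrees x T := fun x => by
    simp only [Forbidden, or_and_right, exists_or]
  simp only [hF, exists_badMove_iff, exists_badTransition_iff, exists_badInit_iff]
  constructor
  · intro H x _
    refine or_iff_not_imp_left.2 fun h₁ => or_iff_not_imp_left.2 fun h₂ =>
      or_iff_not_imp_left.2 fun h₃ => ?_
    rw [not_not] at h₁ h₂ h₃
    -- the profile and the labelling by states that `x` describes
    let σ : Fin n → List (Fin m) → Fin m → Fin m := fun _ h v =>
      if hv : x (false, (h ++ [v]).map Fin.val) < m then ⟨_, hv⟩ else v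
    let q : List (Fin m) → Fin k := fun h =>
      if hv : x (true, h.map Fin.val) < k then ⟨_, hv⟩ else I.machine.init
    have hx : I.Describes x σ := fun h v hh => by
      obtain ⟨y, hy, _⟩ := h₁ h v hh
      have hy' : x (false, (h ++ [v]).map Fin.val) < m := hy ▸ y.2
      simp only [σ, dif_pos hy']
    have hq : ∀ (h : List (Fin m)) (p : Fin k), x (true, h.map Fin.val) = p → q h = p :=
      fun h p hp => by
        have hp' : x (true, h.map Fin.val) < k := hp ▸ p.2
        simp only [q, dif_pos hp']
        exact Fin.ext hp
    have hσ : I.game.toGame.IsProfile I.start σ := by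
      intro i h v hh hi
      obtain ⟨y, hy, hE⟩ := h₁ h v hh
      have hs := hx h v hh
      rw [hy] at hs
      have hi' : I.game.owner v = i := hi
      rw [← hi', ← Fin.ext hs]
      exact hE
    rw [hx.exists_highPayoff_iff hσ, hx.exists_profitableDeviation_iff hσ]
    by_contra! hcon
    refine hcon.1.not_gt (H σ hσ hcon.2 ⟨q, hq _ _ h₃, fun h v hh => ?_⟩)
    obtain ⟨p, p', hp, hp', hs, ho⟩ := h₂ h v hh
    rw [hq _ _ hp, hq _ _ hp']
    refine ⟨hs, fun hv => ?_⟩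
    have := ho hv
    have hv' : I.game.owner v = I.leader := hv
    rwa [hx h v hh, hv', output_encode] at this
  · intro H σ hσ heq ⟨q, hq₀, hq⟩
    -- the assignment that describes the profile and the labelling by states
    let f : ℕ → Fin m := fun a => if ha : a < m then ⟨a, ha⟩ else I.start
    have hf : ∀ h : List (Fin m), (h.map Fin.val).map f = h := fun h => by
      simp [f, Function.comp_def]
    let x : Bool × List ℕ → ℕ := fun a =>
      if a.1 = true then q (a.2.map f) else
        σ (I.game.owner ((a.2.map f).getLastD I.start)) (a.2.map f).dropLast
          ((a.2.map f).getLastD I.start)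
    have hx₁ : ∀ h : List (Fin m), x (true, h.map Fin.val) = q h := fun h => by
      simp only [x, if_true, hf]
    have hx : I.Describes x σ := fun h v _ => by
      have hfv : f v = v := by simp [f]
      simp [x, hf, hfv]
    have hb : ∀ i, x i ≤ numVertices I.encode + numStates I.encode := fun i => by
      rw [numVertices_encode, numStates_encode]
      simp only [x]
      split_ifs
      · exact (Fin.is_lt _).le.trans (Nat.le_add_left _ _)
      · exact (Fin.is_lt _).le.trans (Nat.le_add_right _ _)
    rw [← hx.exists_highPayoff_iff hσ]
    refine (((H x hb).resolve_left ?_).resolve_left ?_).resolve_left ?_ |>.resolve_right ?_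
    · rw [not_not]
      intro h v hh
      exact ⟨_, hx h v hh, hσ _ h v hh rfl⟩
    · rw [not_not]
      intro h v hh
      refine ⟨q h, q (h ++ [v]), hx₁ h, hx₁ _, (hq h v hh).1, fun hv => ?_⟩
      rw [hx h v hh, hv, output_encode]
      exact (hq h v hh).2 hv
    · rw [not_not, ← hq₀]
      exact hx₁ []
    · rw [hx.exists_profitableDeviation_iff hσ, not_not]
      exact heq

end Instance

/-! ### Recursive enumerability -/

theorem rv_iff (r : Rationality) (c : InstanceCode) :
    RV r c ↔ (∀ x : Bool × List ℕ → ℕ, (∀ i, x i ≤ Code.numVertices c + Code.numStates c) →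
      ∃ T, Code.Forbidden r c T ∧ Code.Agrees x T) ∧ Code.Valid c := by
  constructor
  · rintro ⟨n, m, k, I, rfl, hI⟩
    exact ⟨(I.positive_iff r).1 hI, Code.valid_encode I⟩
  · rintro ⟨hx, hc⟩
    refine ⟨_, _, _, Code.toInstance hc.2.1 hc.2.2, Code.encode_toInstance hc, ?_⟩
    rw [Instance.positive_iff, Code.encode_toInstance hc]
    exact hx

theorem detRV_iff (r : Rationality) (c : InstanceCode) :
    DetRV r c ↔ RV r c ∧ Code.Deterministic c := by
  constructor
  · rintro ⟨n, m, k, I, rfl, hd, hI⟩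
    exact ⟨⟨n, m, k, I, rfl, hI⟩, (Code.deterministic_encode I).2 hd⟩
  · rintro ⟨⟨n, m, k, I, rfl, hI⟩, hd⟩
    exact ⟨n, m, k, I, rfl, (Code.deterministic_encode I).1 hd, hI⟩

theorem sigmaOne_rv (r : Rationality) : SigmaOne (RV r) := by
  have hb : Primrec fun c => Code.numVertices c + Code.numStates c := by fun_prop
  exact (((Code.sigmaOne_forbidden r).forall_bounded hb).and_primrecPred
    Code.primrecPred_valid).of_eq fun c => (rv_iff r c).symm

theorem sigmaOne_detRV (r : Rationality) : SigmaOne (DetRV r) :=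
  ((sigmaOne_rv r).and_primrecPred Code.primrecPred_deterministic).of_eq fun c =>
    (detRV_iff r c).symm

end RationalVerification

theorem mainTheorem5 :
    REPred (RationalVerification.RV .nash) ∧
    REPred (RationalVerification.RV .subgamePerfect) ∧
    REPred (RationalVerification.DetRV .nash) ∧
    REPred (RationalVerification.DetRV .subgamePerfect) :=
  ⟨(RationalVerification.sigmaOne_rv _).rePred, (RationalVerification.sigmaOne_rv _).rePred,
    (RationalVerification.sigmaOne_detRV _).rePred, (RationalVerification.sigmaOne_detRV _).rePred⟩
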